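/- Let $n\ge 2$, let $I$ be a set of radii such that $M=\{x\in\mathbb R^n:|x|\in I\}$ is open (for example an open ball centred at $0$, an open annulus centred at $0$, or $\mathbb R^n$), and let $g,h$ be real functions that are $C^\infty$ at every positive $r\in I$, with $1-2r^2g(r)\ne 0$ there. Let $$T(r)=\frac{e^{-\int\frac{4rg(r)}{1-2r^2g(r)}dr}}{(1-2r^2g(r))^2},\qquad \overline T(r)=4\int\frac{g'(r)+2rg(r)^2}{1-2r^2g(r)}\,T(r)\,dr,$$ where the integrals denote arbitrary antiderivatives on the positive radii in $I$ (with arbitrary values at $r=0$ if $0\in I$), and assume that $T(r)-\overline T(r)(r^2-s^2)>0$ for all $r\in I$ and $|s|\le r$. For real constants $\gamma,\varepsilon$ put $$\phi(r,s)=s\,h(r)+\gamma\frac{r^2\sqrt{T-\overline T(r^2-s^2)}}{(T-r^2\overline T)^2}+\gamma s^2\frac{T}{(T-r^2\overline T)^2\sqrt{T-\overline T(r^2-s^2)}}+\varepsilon\frac{\sqrt{T-\overline T(r^2-s^2)}}{T-r^2\overline T},$$ $$F(x,y)=|y|\,\phi\!\left(|x|,\frac{\langle x,y\rangle}{|y|}\right)\quad(x\in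 M,\ y\in\mathbb R^n\setminus\{0\}),\qquad F(x,0)=0.$$ Here a Finsler metric on $M$ is a nonnegative function $F(x,y)$ that is $C^\infty$ for $y\neq0$, positively homogeneous of degree one in $y$, and has positive definite fundamental tensor $g_{ij}=\frac12\partial^2F^2/\partial y^i\partial y^j$ for $y\ne0$. With $G^i=\frac14g^{il}\{(F^2)_{x^ky^l}y^k-(F^2)_{x^l}\}$, it is a Douglas metric if $\frac{\partial^3}{\partial y^j\partial y^k\partial y^l}\left(G^i-\frac1{n+1}\sum_m\frac{\partial G^m}{\partial y^m}y^i\right)=0$ for all $i,j,k,l$. It is of scalar flag curvature if, for linearly independent $y,u$, the flag curvature $$\frac{g_y(R_y(u),u)}{g_y(y,y)g_y(u,u)-g_y(y,u)^2},\qquad R^i{}_k=2\frac{\partial G^i}{\partial x^k}-y^j\frac{\partial^2G^i}{\partial x^j\partial y^k}+2G^j\frac{\partial^2G^i}{\partial y^j\partial y^k}-\frac{\partial G^i}{\partial y^j}\frac{\partial G^j}{\partial y^k},$$ depends only on $(x,y)$ and not on $u$. Then: (1) If $F$ is a Finsler metric on $M$, then $F$ is a Douglas metric of scalar flag curvature.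 (2) If $\gamma\ge0$, $\varepsilon>0$, $\phi(r,s)>0$ for all $r\in I$ and $|s|\le r$, and, in case $0\in M$, $F$ is $C^\infty$ near $(0,y)$ for every $y\neq0$, then $F$ is a Finsler metric on $M$ (and hence, by (1), a Douglas metric of scalar flag curvature). (3) For $r\in I$ and $0<|s|<r$, $$\frac{\partial}{\partial s}\left(\frac{\phi(r,s)}{s}\right)=-\frac{\eta(\varphi(r,s))}{s^2\sqrt{r^2-s^2}},\qquad \varphi(r,s)=\frac{r^2-s^2}{(r^2-s^2)\overline T(r)-T(r)},$$ where $\eta(x)=\sqrt{-x}\,(\gamma(-x)^m+\varepsilon)$ with $m=1$. -/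

import Mathlib

open scoped ContDiff

noncomputable section

namespace SphSymFinsler

/-- Euclidean `n`-space. Its tangent bundle is identified with pairs `(x, y)`, and a function on the
tangent bundle is written in curried form `x ↦ y ↦ f x y`. -/
abbrev E (n : ℕ) := EuclideanSpace ℝ (Fin n)

variable {n : ℕ}

/-- The partial derivative `∂f/∂xⁱ` with respect to the base point. -/
def partialX (i : Fin n) (f : E n → E n → ℝ) : E n → E n → ℝ :=
  fun x y => fderiv ℝ (fun z => f z y) x (EuclideanSpace.single i 1)

/-- The partial derivative `∂f/∂yⁱ` with respect to the tangent vector. -/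
def partialY (i : Fin n) (f : E n → E n → ℝ) : E n → E n → ℝ :=
  fun x y => fderiv ℝ (fun w => f x w) y (EuclideanSpace.single i 1)

/-- The fundamental tensor `g_{ij}(x, y) = ½ ∂²(F²)/∂yⁱ∂yʲ`. -/
def fundTensor (F : E n → E n → ℝ) (x y : E n) : Matrix (Fin n) (Fin n) ℝ :=
  Matrix.of fun i j => 1 / 2 * partialY i (partialY j (fun x y => F x y ^ 2)) x y

/-- `F` is a Finsler metric on the open set `M`: nonnegative, smooth off the zero section, positively
homogeneous of degree one and with positive definite fundamental tensor. -/
structure IsFinslerMetric (M : Set (E n)) (F : E n → E n → ℝ) : Prop where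
  nonneg : ∀ x ∈ M, ∀ y, 0 ≤ F x y
  smooth : ∀ x ∈ M, ∀ y, y ≠ 0 → ContDiffAt ℝ ∞ (fun p : E n × E n => F p.1 p.2) (x, y)
  homogeneous : ∀ x ∈ M, ∀ y, ∀ c : ℝ, 0 < c → F x (c • y) = c * F x y
  posDef : ∀ x ∈ M, ∀ y, y ≠ 0 → (fundTensor F x y).PosDef

/-- The geodesic (spray) coefficients
`Gⁱ = ¼ gⁱˡ ((∂²(F²)/∂xᵏ∂yˡ) yᵏ - ∂(F²)/∂xˡ)`. -/
def geodesicCoeff (F : E n → E n → ℝ) (i : Fin n) (x y : E n) : ℝ :=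
  1 / 4 * ∑ l, (fundTensor F x y)⁻¹ i l *
    ((∑ k, partialX k (partialY l (fun x y => F x y ^ 2)) x y * y k)
      - partialX l (fun x y => F x y ^ 2) x y)

/-- The Douglas curvature
`D_jⁱ_kl = ∂³/∂yʲ∂yᵏ∂yˡ (Gⁱ - (n+1)⁻¹ (∑ₘ ∂Gᵐ/∂yᵐ) yⁱ)`. -/
def douglasCurvature (F : E n → E n → ℝ) (j i k l : Fin n) : E n → E n → ℝ :=
  partialY j (partialY k (partialY l (fun x y =>
    geodesicCoeff F i x y
      - 1 / ((n : ℝ) + 1) * (∑ m, partialY m (geodesicCoeff F m) x y) * y i)))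

/-- Vanishing of the Douglas curvature over `M`. -/
def IsDouglas (M : Set (E n)) (F : E n → E n → ℝ) : Prop :=
  ∀ x ∈ M, ∀ y, y ≠ 0 → ∀ j i k l : Fin n, douglasCurvature F j i k l x y = 0

/-- The Riemann curvature
`Rⁱ_k = 2 ∂Gⁱ/∂xᵏ - yʲ ∂²Gⁱ/∂xʲ∂yᵏ + 2 Gʲ ∂²Gⁱ/∂yʲ∂yᵏ - (∂Gⁱ/∂yʲ)(∂Gʲ/∂yᵏ)`. -/
def riemannCurvature (F : E n → E n → ℝ) (i k : Fin n) (x y : E n) : ℝ :=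
  2 * partialX k (geodesicCoeff F i) x y
    - (∑ j, y j * partialX j (partialY k (geodesicCoeff F i)) x y)
    + 2 * (∑ j, geodesicCoeff F j x y * partialY j (partialY k (geodesicCoeff F i)) x y)
    - ∑ j, partialY j (geodesicCoeff F i) x y * partialY k (geodesicCoeff F j) x y

/-- The inner product `g_y(u, v) = g_{ij}(x, y) uⁱ vʲ`. -/
def fundInner (F : E n → E n → ℝ) (x y u v : E n) : ℝ :=
  ∑ i, ∑ j, fundTensor F x y i j * u i * v j

/-- The endomorphism `R_y(u) = Rⁱ_k uᵏ ∂/∂xⁱ`. -/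
def riemannMap (F : E n → E n → ℝ) (x y u : E n) : E n :=
  WithLp.toLp 2 fun i => ∑ k, riemannCurvature F i k x y * u k

/-- The flag curvature of the flag with pole `y` in the plane spanned by `y` and `u`. -/
def flagCurvature (F : E n → E n → ℝ) (x y u : E n) : ℝ :=
  fundInner F x y (riemannMap F x y u) u
    / (fundInner F x y y y * fundInner F x y u u - fundInner F x y y u ^ 2)

/-- `F` is of scalar flag curvature over `M`: the flag curvature depends only on `(x, y)` and not on
the plane containing `y`. -/
def HasScalarFlagCurvature (M : Set (E n)) (F : E n → E n → ℝ) : Prop :=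
  ∃ K : E n → E n → ℝ, ∀ x ∈ M, ∀ y u : E n, LinearIndependent ℝ ![y, u] →
    flagCurvature F x y u = K x y

/-- The spherically symmetric function `F(x, y) = |y| φ(|x|, ⟨x, y⟩ / |y|)`. -/
def sphMetric (n : ℕ) (φ : ℝ → ℝ → ℝ) (x y : E n) : ℝ :=
  ‖y‖ * φ ‖x‖ (inner ℝ x y / ‖y‖)

/-- The spherically symmetric set of all points of Euclidean `n`-space with radius in `I`. -/
def radialDomain (n : ℕ) (I : Set ℝ) : Set (E n) := {x | ‖x‖ ∈ I}

/-- The function `T = exp(-A) / (1 - 2 r² g)²`, for an antiderivative `A` of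
`4 r g / (1 - 2 r² g)`. -/
def Tfun (g A : ℝ → ℝ) (r : ℝ) : ℝ :=
  Real.exp (-A r) / (1 - 2 * r ^ 2 * g r) ^ 2

/-- `A` and `Tb` are choices, over the positive radii in `I`, of the indefinite integrals
`A = ∫ 4 r g / (1 - 2 r² g) dr` and `Tb = 4 ∫ (g' + 2 r g²) / (1 - 2 r² g) T dr`, the second being
`T̄`. -/
structure IsIntegralChoice (I : Set ℝ) (g A Tb : ℝ → ℝ) : Prop where
  hasDerivAt_A : ∀ r ∈ I, 0 < r →
    HasDerivAt A (4 * r * g r / (1 - 2 * r ^ 2 * g r)) r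
  hasDerivAt_Tb : ∀ r ∈ I, 0 < r →
    HasDerivAt Tb
      (4 * ((deriv g r + 2 * r * g r ^ 2) / (1 - 2 * r ^ 2 * g r) * Tfun g A r)) r

/-- The explicit function `φ(r, s)` built from `h`, `T`, `T̄` and the constants `γ`, `ε`. -/
def phi (h T Tb : ℝ → ℝ) (γ ε : ℝ) (r s : ℝ) : ℝ :=
  s * h r
    + γ * (r ^ 2 * √(T r - Tb r * (r ^ 2 - s ^ 2)) / (T r - r ^ 2 * Tb r) ^ 2)
    + γ * s ^ 2 *
        (T r / ((T r - r ^ 2 * Tb r) ^ 2 * √(T r - Tb r * (r ^ 2 - s ^ 2))))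
    + ε * (√(T r - Tb r * (r ^ 2 - s ^ 2)) / (T r - r ^ 2 * Tb r))

/-- The explicit metric `F(x, y) = |y| φ(|x|, ⟨x, y⟩ / |y|)` for the function `φ = phi h T Tb γ ε`. -/
def explicitMetric (n : ℕ) (h T Tb : ℝ → ℝ) (γ ε : ℝ) : E n → E n → ℝ :=
  sphMetric n (phi h T Tb γ ε)

/-- The function `η(x) = √(-x) (γ (-x)ᵐ + ε)`. -/
def etaFun (m : ℕ) (γ ε x : ℝ) : ℝ := √(-x) * (γ * (-x) ^ m + ε)

/-- The function `φ(r, s) = (r² - s²) / ((r² - s²) T̄ - T)` in which `η` is evaluated. -/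
def varphi (T Tb : ℝ → ℝ) (r s : ℝ) : ℝ :=
  (r ^ 2 - s ^ 2) / ((r ^ 2 - s ^ 2) * Tb r - T r)

end SphSymFinsler

end

/-! Write r = |x|, b = ⟨x,y⟩, c = T − r²T̄, α² = c|y|² + T̄b², δ = r²|y|² − b², and on positive
radii q = (g' + 2rg²)/(r(1 − 2r²g)). The comparison spray is Q·x with Q = g|y|² + qb², quadratic in
y. The definitions of T and T̄ amount to T' = 4r(g + qr²)T and T̄' = 4rqT, which is what makes α a
first integral of the field S = (y, −2Qx); δ is another one.

In these terms F = hb + εα/c + γ(r²α/c² + Tb²/(c²α)). It satisfies the Rapcsák equation S(F_w) =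
F_{x^w} for every vertical direction w (`RadialData.dirDeriv_spray_dirDeriv`). Hence F has the
unparametrized geodesics of the comparison spray: G = Py + Qx with P = S(F)/(2F)
(`RadialData.geodesicVec_eq`).

Both curvature statements follow from this shape. Subtracting the trace of the y-derivative of G
removes P and leaves a polynomial of degree two in y, so the Douglas curvature vanishes. In R_y(u)
the terms are multiples of u, y and x, and the coefficient of x is zero by the equation relating g'
and q (`RadialData.sprayCoeff_identity`). So R_y(u) = μu + τy; since R_y(u) is g_y-orthogonal to y,
the flag curvature is μ/F² for every flag. A point at the origin is reached by continuity, punctured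
neighbourhoods being nonempty.

For the Finsler property, |y|²F_uu = N·a + κ·w², where a is the Gram determinant of y and u, and w²
≤ aδ by Cauchy–Schwarz. Both N and N + κδ are positive for γ ≥ 0 and ε > 0, which gives convexity
transversally to y; positivity of F handles the radial direction. At the origin F is a positive
multiple of the Euclidean norm.

The integral formula is a differentiation in s at fixed r, with −φ(r,s) = (r² − s²)/(T − T̄(r² −
s²)). -/

namespace SphSymFinsler

variable {n : ℕ} {V : Type*} [NormedAddCommGroup V] [NormedSpace ℝ V]

/-! ### Directional derivatives on the tangent bundle -/

/-- The derivative of `f`, seen as a function of `(x, y)`, in the direction `v`. -/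
noncomputable def dirDeriv (v : E n × E n) (f : E n → E n → V) (x y : E n) : V :=
  fderiv ℝ (fun p : E n × E n => f p.1 p.2) (x, y) v

/-- Smoothness of a function in curried form at every point of `U`. -/
def SmoothOn (U : Set (E n × E n)) (f : E n → E n → V) : Prop :=
  ∀ p ∈ U, ContDiffAt ℝ ∞ (fun p : E n × E n => f p.1 p.2) p

theorem SmoothOn.differentiableAt {U : Set (E n × E n)} {f : E n → E n → V} (hf : SmoothOn U f)
    {x y : E n} (hp : (x, y) ∈ U) :
    DifferentiableAt ℝ (fun p : E n × E n => f p.1 p.2) (x, y) :=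
  (hf _ hp).differentiableAt (by simp)

theorem SmoothOn.congr {U : Set (E n × E n)} (hU : IsOpen U) {f g : E n → E n → V}
    (hf : SmoothOn U f) (h : ∀ x y, (x, y) ∈ U → g x y = f x y) : SmoothOn U g := by
  intro p hp
  refine (hf p hp).congr_of_eventuallyEq ?_
  filter_upwards [hU.mem_nhds hp] with q hq using h _ _ hq

theorem SmoothOn.fderiv {U : Set (E n × E n)} {f : E n → E n → V} (hf : SmoothOn U f)
    {p : E n × E n} (hp : p ∈ U) :
    ContDiffAt ℝ ∞ (fderiv ℝ (fun p : E n × E n => f p.1 p.2)) p :=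
  (hf p hp).fderiv_right (by simp)

theorem SmoothOn.dirDeriv {U : Set (E n × E n)} {f : E n → E n → V} (hf : SmoothOn U f)
    (v : E n × E n) : SmoothOn U (dirDeriv v f) :=
  fun _ hp => (hf.fderiv hp).clm_apply contDiffAt_const

theorem SmoothOn.dirDeriv_field {U : Set (E n × E n)} {f : E n → E n → V} (hf : SmoothOn U f)
    {W : E n → E n → E n × E n} (hW : SmoothOn U W) :
    SmoothOn U (fun x y => SphSymFinsler.dirDeriv (W x y) f x y) :=
  fun p hp => (hf.fderiv hp).clm_apply (hW p hp)

theorem dirDeriv_add_dir (v w : E n × E n) (f : E n → E n → V) (x y : E n) :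
    dirDeriv (v + w) f x y = dirDeriv v f x y + dirDeriv w f x y := map_add _ _ _

theorem dirDeriv_smul_dir (c : ℝ) (v : E n × E n) (f : E n → E n → V) (x y : E n) :
    dirDeriv (c • v) f x y = c • dirDeriv v f x y := map_smul _ _ _

theorem dirDeriv_congr {U : Set (E n × E n)} (hU : IsOpen U) {f g : E n → E n → V}
    (h : ∀ x y, (x, y) ∈ U → f x y = g x y) {x y : E n} (hp : (x, y) ∈ U) (v : E n × E n) :
    dirDeriv v f x y = dirDeriv v g x y := by
  have : (fun p : E n × E n => f p.1 p.2) =ᶠ[nhds (x, y)] fun p => g p.1 p.2 := by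
    filter_upwards [hU.mem_nhds hp] with q hq using h _ _ hq
  simp only [dirDeriv, this.fderiv_eq]

theorem dirDeriv_comm {U : Set (E n × E n)} {f : E n → E n → V} (hf : SmoothOn U f)
    {x y : E n} (hp : (x, y) ∈ U) (v w : E n × E n) :
    dirDeriv v (dirDeriv w f) x y = dirDeriv w (dirDeriv v f) x y := by
  have hd := (hf.fderiv hp).differentiableAt (by simp)
  have key : ∀ v w : E n × E n, dirDeriv v (dirDeriv w f) x y =
      fderiv ℝ (fderiv ℝ (fun p : E n × E n => f p.1 p.2)) (x, y) v w := by
    intro v w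
    have := hd.hasFDerivAt.clm_apply (hasFDerivAt_const w (x, y))
    have h2 := this.fderiv
    simp only [dirDeriv]
    erw [h2]
    simp
  rw [key, key]
  exact (hf _ hp).isSymmSndFDerivAt
    (by
      rw [minSmoothness_of_isRCLikeNormedField]
      exact WithTop.coe_le_coe.2 (le_top : (2 : ℕ∞) ≤ ⊤)) v w

/-- The derivative of the derivative of `f` along a vector field. -/
theorem dirDeriv_field {U : Set (E n × E n)} {f : E n → E n → V} (hf : SmoothOn U f)
    {W : E n → E n → E n × E n} (hW : SmoothOn U W) {x y : E n} (hp : (x, y) ∈ U)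
    (v : E n × E n) :
    dirDeriv v (fun x y => dirDeriv (W x y) f x y) x y =
      dirDeriv (dirDeriv v W x y) f x y + dirDeriv v (dirDeriv (W x y) f) x y := by
  have hd := (hf.fderiv hp).differentiableAt (by simp)
  have h1 := (hd.hasFDerivAt.clm_apply (hasFDerivAt_const (W x y) (x, y))).fderiv
  have h2 := (hd.hasFDerivAt.clm_apply (hW.differentiableAt hp).hasFDerivAt).fderiv
  simp only [dirDeriv] at *
  erw [h1, h2]
  simp

theorem dirDeriv_add {U : Set (E n × E n)} {f g : E n → E n → V} (hf : SmoothOn U f)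
    (hg : SmoothOn U g) {x y : E n} (hp : (x, y) ∈ U) (v : E n × E n) :
    dirDeriv v (fun x y => f x y + g x y) x y = dirDeriv v f x y + dirDeriv v g x y := by
  simp only [dirDeriv]
  rw [fderiv_fun_add (hf.differentiableAt hp) (hg.differentiableAt hp)]
  rfl

theorem dirDeriv_smul {U : Set (E n × E n)} {c : E n → E n → ℝ} {f : E n → E n → V}
    (hc : SmoothOn U c) (hf : SmoothOn U f) {x y : E n} (hp : (x, y) ∈ U) (v : E n × E n) :
    dirDeriv v (fun x y => c x y • f x y) x y =
      c x y • dirDeriv v f x y + dirDeriv v c x y • f x y := by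
  simp only [dirDeriv]
  rw [fderiv_fun_smul (hc.differentiableAt hp) (hf.differentiableAt hp)]
  simp

theorem dirDeriv_mul {U : Set (E n × E n)} {c f : E n → E n → ℝ}
    (hc : SmoothOn U c) (hf : SmoothOn U f) {x y : E n} (hp : (x, y) ∈ U) (v : E n × E n) :
    dirDeriv v (fun x y => c x y * f x y) x y =
      c x y * dirDeriv v f x y + dirDeriv v c x y * f x y := dirDeriv_smul hc hf hp v

theorem dirDeriv_const (c : V) (x y : E n) (v : E n × E n) :
    dirDeriv v (fun _ _ => c) x y = 0 := by
  simp [dirDeriv]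

theorem dirDeriv_fst (x y : E n) (v : E n × E n) :
    dirDeriv v (fun x _ => x) x y = v.1 := by
  simp only [dirDeriv]
  rw [fderiv_fst]; rfl

theorem dirDeriv_snd (x y : E n) (v : E n × E n) :
    dirDeriv v (fun _ y => y) x y = v.2 := by
  simp only [dirDeriv]
  rw [fderiv_snd]; rfl

theorem dirDeriv_prodMk {U : Set (E n × E n)} {f g : E n → E n → E n}
    (hf : SmoothOn U f) (hg : SmoothOn U g) {x y : E n} (hp : (x, y) ∈ U) (v : E n × E n) :
    dirDeriv v (fun x y => (f x y, g x y)) x y = (dirDeriv v f x y, dirDeriv v g x y) := by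
  simp only [dirDeriv]
  rw [(hf.differentiableAt hp).fderiv_prodMk (hg.differentiableAt hp)]
  rfl

theorem SmoothOn.fst (U : Set (E n × E n)) : SmoothOn U (fun x _ => x) :=
  fun _ _ => contDiffAt_fst

theorem SmoothOn.snd (U : Set (E n × E n)) : SmoothOn U (fun _ y => y) :=
  fun _ _ => contDiffAt_snd

theorem SmoothOn.const (U : Set (E n × E n)) (c : V) : SmoothOn U (fun _ _ => c) :=
  fun _ _ => contDiffAt_const

theorem SmoothOn.add {U : Set (E n × E n)} {f g : E n → E n → V} (hf : SmoothOn U f)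
    (hg : SmoothOn U g) : SmoothOn U (fun x y => f x y + g x y) :=
  fun p hp => (hf p hp).add (hg p hp)

theorem SmoothOn.sub {U : Set (E n × E n)} {f g : E n → E n → V} (hf : SmoothOn U f)
    (hg : SmoothOn U g) : SmoothOn U (fun x y => f x y - g x y) :=
  fun p hp => (hf p hp).sub (hg p hp)

theorem SmoothOn.smul {U : Set (E n × E n)} {c : E n → E n → ℝ} {f : E n → E n → V}
    (hc : SmoothOn U c) (hf : SmoothOn U f) : SmoothOn U (fun x y => c x y • f x y) :=
  fun p hp => (hc p hp).smul (hf p hp)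

theorem SmoothOn.mul {U : Set (E n × E n)} {c f : E n → E n → ℝ}
    (hc : SmoothOn U c) (hf : SmoothOn U f) : SmoothOn U (fun x y => c x y * f x y) :=
  fun p hp => (hc p hp).mul (hf p hp)

theorem SmoothOn.div {U : Set (E n × E n)} {f c : E n → E n → ℝ}
    (hf : SmoothOn U f) (hc : SmoothOn U c) (h : ∀ x y, (x, y) ∈ U → c x y ≠ 0) :
    SmoothOn U (fun x y => f x y / c x y) :=
  fun p hp => (hf p hp).div (hc p hp) (h _ _ hp)

theorem SmoothOn.sum {U : Set (E n × E n)} {ι : Type*} {s : Finset ι} {f : ι → E n → E n → V}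
    (hf : ∀ i ∈ s, SmoothOn U (f i)) : SmoothOn U (fun x y => ∑ i ∈ s, f i x y) :=
  fun p hp => ContDiffAt.sum fun i hi => hf i hi p hp

theorem SmoothOn.prod {U : Set (E n × E n)} {ι : Type*} {s : Finset ι} {f : ι → E n → E n → ℝ}
    (hf : ∀ i ∈ s, SmoothOn U (f i)) : SmoothOn U (fun x y => ∏ i ∈ s, f i x y) :=
  fun p hp => contDiffAt_prod fun i hi => hf i hi p hp

theorem SmoothOn.prodMk {U : Set (E n × E n)} {f g : E n → E n → E n}
    (hf : SmoothOn U f) (hg : SmoothOn U g) : SmoothOn U (fun x y => (f x y, g x y)) :=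
  fun p hp => (hf p hp).prodMk (hg p hp)

theorem SmoothOn.apply {U : Set (E n × E n)} {f : E n → E n → E n} (hf : SmoothOn U f)
    (i : Fin n) : SmoothOn U (fun x y => f x y i) :=
  fun p hp => contDiffAt_euclidean.1 (hf p hp) i

theorem smoothOn_of_apply {U : Set (E n × E n)} {f : E n → E n → E n}
    (hf : ∀ i, SmoothOn U (fun x y => f x y i)) : SmoothOn U f :=
  fun p hp => contDiffAt_euclidean.2 fun i => hf i p hp

theorem dirDeriv_apply {U : Set (E n × E n)} {f : E n → E n → E n} (hf : SmoothOn U f)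
    {x y : E n} (hp : (x, y) ∈ U) (v : E n × E n) (i : Fin n) :
    dirDeriv v (fun x y => f x y i) x y = dirDeriv v f x y i := by
  have h := (EuclideanSpace.proj (𝕜 := ℝ) i).hasFDerivAt.comp (x, y)
    (hf.differentiableAt hp).hasFDerivAt
  have := h.fderiv
  simp only [dirDeriv]
  erw [this]
  rfl

theorem sum_smul_single (u : E n) : ∑ i, u i • EuclideanSpace.single i (1 : ℝ) = u := by
  ext j
  simp [Pi.single_apply]

theorem dirDeriv_eq_sum_fst (u : E n) (f : E n → E n → V) (x y : E n) :
    dirDeriv (u, 0) f x y = ∑ i, u i • dirDeriv (EuclideanSpace.single i 1, 0) f x y := by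
  have : (u, (0 : E n)) = ∑ i, u i • ((EuclideanSpace.single i (1 : ℝ) : E n), (0 : E n)) := by
    ext1
    · rw [Prod.fst_sum]; simp [sum_smul_single]
    · rw [Prod.snd_sum]; simp
  conv_lhs => rw [this]
  simp only [dirDeriv, map_sum, map_smul]

theorem dirDeriv_eq_sum_snd (u : E n) (f : E n → E n → V) (x y : E n) :
    dirDeriv (0, u) f x y = ∑ i, u i • dirDeriv (0, EuclideanSpace.single i 1) f x y := by
  have : ((0 : E n), u) = ∑ i, u i • ((0 : E n), (EuclideanSpace.single i (1 : ℝ) : E n)) := by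
    ext1
    · rw [Prod.fst_sum]; simp
    · rw [Prod.snd_sum]; simp [sum_smul_single]
  conv_lhs => rw [this]
  simp only [dirDeriv, map_sum, map_smul]

theorem dirDeriv_split (a b : E n) (f : E n → E n → V) (x y : E n) :
    dirDeriv (a, b) f x y = dirDeriv (a, 0) f x y + dirDeriv (0, b) f x y := by
  rw [← dirDeriv_add_dir]; simp

theorem dirDeriv_snd_smul (c : ℝ) (b : E n) (f : E n → E n → V) (x y : E n) :
    dirDeriv (0, c • b) f x y = c • dirDeriv (0, b) f x y := by
  rw [← dirDeriv_smul_dir]; simp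

theorem dirDeriv_snd_add (a b : E n) (f : E n → E n → V) (x y : E n) :
    dirDeriv (0, a + b) f x y = dirDeriv (0, a) f x y + dirDeriv (0, b) f x y := by
  rw [← dirDeriv_add_dir]; simp

/-- A function differentiable along a line has the expected directional derivative. -/
theorem dirDeriv_eq_of_hasDerivAt {f : E n → E n → V} {x y : E n}
    (hf : DifferentiableAt ℝ (fun p : E n × E n => f p.1 p.2) (x, y)) {a b : E n} {d : V}
    (h : HasDerivAt (fun t : ℝ => f (x + t • a) (y + t • b)) d 0) :
    dirDeriv (a, b) f x y = d := by
  have hl : HasDerivAt (fun t : ℝ => ((x, y) : E n × E n) + t • (a, b)) (a, b) 0 := by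
    simpa using ((hasDerivAt_id (0 : ℝ)).smul_const ((a, b) : E n × E n)).const_add (x, y)
  have hf' : HasFDerivAt (fun p : E n × E n => f p.1 p.2)
      (fderiv ℝ (fun p : E n × E n => f p.1 p.2) (x, y))
      ((fun t : ℝ => ((x, y) : E n × E n) + t • (a, b)) 0) := by
    simpa using hf.hasFDerivAt
  have := hf'.comp_hasDerivAt (0 : ℝ) hl
  exact this.unique h

/-! ### Partial derivatives -/

/-- Coordinate partial derivatives are moved to directional derivatives on the tangent bundle, where
commutation and differentiation along vector fields are available without indices. -/
theorem partialX_eq {U : Set (E n × E n)} {f : E n → E n → ℝ} (hf : SmoothOn U f) {x y : E n}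
    (hp : (x, y) ∈ U) (i : Fin n) :
    partialX i f x y = dirDeriv (EuclideanSpace.single i 1, 0) f x y := by
  have h1 : HasFDerivAt (fun z : E n => (z, y)) (ContinuousLinearMap.inl ℝ (E n) (E n)) x :=
    hasFDerivAt_prodMk_left x y
  have := ((hf.differentiableAt hp).hasFDerivAt.comp x h1).fderiv
  simp only [partialX, dirDeriv]
  erw [this]
  simp

theorem partialY_eq {U : Set (E n × E n)} {f : E n → E n → ℝ} (hf : SmoothOn U f) {x y : E n}
    (hp : (x, y) ∈ U) (i : Fin n) :
    partialY i f x y = dirDeriv (0, EuclideanSpace.single i 1) f x y := by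
  have h1 : HasFDerivAt (fun z : E n => (x, z)) (ContinuousLinearMap.inr ℝ (E n) (E n)) y :=
    hasFDerivAt_prodMk_right x y
  have := ((hf.differentiableAt hp).hasFDerivAt.comp y h1).fderiv
  simp only [partialY, dirDeriv]
  erw [this]
  simp

theorem partialX_congr {U : Set (E n × E n)} (hU : IsOpen U) {f g : E n → E n → ℝ}
    (h : ∀ x y, (x, y) ∈ U → f x y = g x y) {x y : E n} (hp : (x, y) ∈ U) (i : Fin n) :
    partialX i f x y = partialX i g x y := by
  have hc : Continuous fun z : E n => (z, y) := by fun_prop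
  have : (fun z => f z y) =ᶠ[nhds x] fun z => g z y := by
    filter_upwards [hc.continuousAt.preimage_mem_nhds (hU.mem_nhds hp)] with q hq using h _ _ hq
  simp only [partialX, this.fderiv_eq]

theorem partialY_congr {U : Set (E n × E n)} (hU : IsOpen U) {f g : E n → E n → ℝ}
    (h : ∀ x y, (x, y) ∈ U → f x y = g x y) {x y : E n} (hp : (x, y) ∈ U) (i : Fin n) :
    partialY i f x y = partialY i g x y := by
  have hc : Continuous fun z : E n => (x, z) := by fun_prop
  have : (fun z => f x z) =ᶠ[nhds y] fun z => g x z := by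
    filter_upwards [hc.continuousAt.preimage_mem_nhds (hU.mem_nhds hp)] with q hq using h _ _ hq
  simp only [partialY, this.fderiv_eq]

theorem SmoothOn.partialX {U : Set (E n × E n)} (hU : IsOpen U) {f : E n → E n → ℝ}
    (hf : SmoothOn U f) (i : Fin n) : SmoothOn U (partialX i f) :=
  (hf.dirDeriv _).congr hU fun _ _ hp => partialX_eq hf hp i

theorem SmoothOn.partialY {U : Set (E n × E n)} (hU : IsOpen U) {f : E n → E n → ℝ}
    (hf : SmoothOn U f) (i : Fin n) : SmoothOn U (partialY i f) :=
  (hf.dirDeriv _).congr hU fun _ _ hp => partialY_eq hf hp i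

theorem partialX_partialY_eq {U : Set (E n × E n)} (hU : IsOpen U) {f : E n → E n → ℝ}
    (hf : SmoothOn U f) {x y : E n} (hp : (x, y) ∈ U) (i j : Fin n) :
    partialX i (partialY j f) x y = dirDeriv (EuclideanSpace.single i 1, 0)
      (dirDeriv (0, EuclideanSpace.single j 1) f) x y := by
  rw [partialX_congr hU (fun _ _ hp => partialY_eq hf hp j) hp, partialX_eq (hf.dirDeriv _) hp]

theorem partialY_partialY_eq {U : Set (E n × E n)} (hU : IsOpen U) {f : E n → E n → ℝ}
    (hf : SmoothOn U f) {x y : E n} (hp : (x, y) ∈ U) (i j : Fin n) :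
    partialY i (partialY j f) x y = dirDeriv (0, EuclideanSpace.single i 1)
      (dirDeriv (0, EuclideanSpace.single j 1) f) x y := by
  rw [partialY_congr hU (fun _ _ hp => partialY_eq hf hp j) hp, partialY_eq (hf.dirDeriv _) hp]

/-! ### The spray of a Finsler metric -/

/-- The nonzero tangent vectors over `M`. -/
def slitTangent (M : Set (E n)) : Set (E n × E n) := {p | p.1 ∈ M ∧ p.2 ≠ 0}

theorem isOpen_slitTangent {M : Set (E n)} (hM : IsOpen M) : IsOpen (slitTangent M) :=
  (hM.preimage continuous_fst).inter (isOpen_ne.preimage continuous_snd)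

/-- The geodesic coefficients of `F`, as a vector. -/
noncomputable def geodesicVec (F : E n → E n → ℝ) (x y : E n) : E n :=
  WithLp.toLp 2 fun i => geodesicCoeff F i x y

/-! ### Geodesic coefficients and the Euler–Lagrange equation. -/

section energy

variable {U : Set (E n × E n)} (hU : IsOpen U) {F : E n → E n → ℝ}
  (hL : SmoothOn U fun x y => F x y ^ 2)

include hU hL

theorem fundTensor_apply {x y : E n} (hp : (x, y) ∈ U) (i j : Fin n) :
    fundTensor F x y i j = 1 / 2 * dirDeriv (0, EuclideanSpace.single i 1)
      (dirDeriv (0, EuclideanSpace.single j 1) fun x y => F x y ^ 2) x y := by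
  simp only [fundTensor, Matrix.of_apply, partialY_partialY_eq hU hL hp]

theorem fundTensor_symm {x y : E n} (hp : (x, y) ∈ U) (i j : Fin n) :
    fundTensor F x y i j = fundTensor F x y j i := by
  rw [fundTensor_apply hU hL hp, fundTensor_apply hU hL hp, dirDeriv_comm hL hp]

theorem fundTensor_mulVec {x y : E n} (hp : (x, y) ∈ U) (u : E n) (l : Fin n) :
    ((fundTensor F x y).mulVec u) l = 1 / 2 * dirDeriv (0, u)
      (dirDeriv (0, EuclideanSpace.single l 1) fun x y => F x y ^ 2) x y := by
  rw [dirDeriv_eq_sum_snd, Finset.mul_sum]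
  simp only [Matrix.mulVec, dotProduct]
  refine Finset.sum_congr rfl fun i _ => ?_
  rw [fundTensor_symm hU hL hp, fundTensor_apply hU hL hp, smul_eq_mul]
  ring

theorem fundInner_eq {x y : E n} (hp : (x, y) ∈ U) (u v : E n) :
    fundInner F x y u v = 1 / 2 * dirDeriv (0, u)
      (dirDeriv (0, v) fun x y => F x y ^ 2) x y := by
  rw [dirDeriv_comm hL hp, dirDeriv_eq_sum_snd v, Finset.mul_sum]
  simp only [dirDeriv_comm hL hp (0, EuclideanSpace.single _ 1) (0, u), smul_eq_mul]
  have := fun l => fundTensor_mulVec hU hL hp u l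
  simp only [fundInner]
  rw [Finset.sum_comm]
  refine Finset.sum_congr rfl fun l _ => ?_
  have h := this l
  simp only [Matrix.mulVec, dotProduct] at h
  rw [mul_left_comm, ← h, Finset.mul_sum]
  refine Finset.sum_congr rfl fun i _ => ?_
  rw [fundTensor_symm hU hL hp]
  ring

theorem smoothOn_fundTensor (i j : Fin n) : SmoothOn U fun x y => fundTensor F x y i j :=
  ((SmoothOn.const U (1 / 2 : ℝ)).mul ((hL.dirDeriv _).dirDeriv _)).congr hU
    fun _ _ hp => fundTensor_apply hU hL hp i j

omit hU hL in
theorem smoothOn_det {A : E n → E n → Matrix (Fin n) (Fin n) ℝ}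
    (hA : ∀ i j, SmoothOn U fun x y => A x y i j) : SmoothOn U fun x y => (A x y).det := by
  simp only [Matrix.det_apply']
  exact SmoothOn.sum fun σ _ => (SmoothOn.const U _).mul (SmoothOn.prod fun i _ => hA _ _)

theorem smoothOn_geodesicCoeff (hdet : ∀ x y, (x, y) ∈ U → (fundTensor F x y).det ≠ 0)
    (i : Fin n) : SmoothOn U (geodesicCoeff F i) := by
  -- Cramer's rule: the entries of the inverse are adjugate entries over the determinant, hence
  -- rational in smooth functions.
  have hinv : ∀ i j, SmoothOn U fun x y => (fundTensor F x y)⁻¹ i j := by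
    intro i j
    have hadj : SmoothOn U fun x y => (fundTensor F x y).adjugate i j := by
      simp only [Matrix.adjugate_apply]
      refine smoothOn_det fun k l => ?_
      by_cases hk : k = j
      · subst hk
        simpa using SmoothOn.const U _
      · simpa [Matrix.updateRow_ne hk] using smoothOn_fundTensor hU hL k l
    refine (hadj.div (smoothOn_det (smoothOn_fundTensor hU hL)) hdet).congr hU fun x y _ => ?_
    rw [Matrix.inv_def, Matrix.smul_apply, Ring.inverse_eq_inv', smul_eq_mul, div_eq_inv_mul]
  refine (SmoothOn.const U (1 / 4 : ℝ)).mul (SmoothOn.sum fun l _ => (hinv i l).mul ?_)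
  refine (SmoothOn.sum fun k _ => ?_).sub (hL.partialX hU l)
  exact ((hL.partialY hU l).partialX hU k).mul ((SmoothOn.snd U).apply k)

theorem geodesicCoeff_eq {x y : E n} (hp : (x, y) ∈ U) (i : Fin n) :
    geodesicCoeff F i x y = ((fundTensor F x y)⁻¹.mulVec fun l => 1 / 4 *
      (dirDeriv (y, 0) (dirDeriv (0, EuclideanSpace.single l 1) fun x y => F x y ^ 2) x y
        - dirDeriv (EuclideanSpace.single l 1, 0) (fun x y => F x y ^ 2) x y)) i := by
  simp only [geodesicCoeff, Matrix.mulVec, dotProduct, Finset.mul_sum]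
  refine Finset.sum_congr rfl fun l _ => ?_
  rw [dirDeriv_eq_sum_fst y, partialX_eq hL hp]
  simp only [partialX_partialY_eq hU hL hp, smul_eq_mul, mul_comm (y _)]
  ring

/-- Multiplying the definition of the geodesic coefficients by the fundamental tensor gives a linear
system with a unique solution. Candidates for the spray can then be recognised from the
Euler–Lagrange equation, and the inverse tensor never has to be computed. -/
theorem eulerLagrange_iff {x y : E n} (hp : (x, y) ∈ U)
    (hdet : (fundTensor F x y).det ≠ 0) (G : E n) :
    G = geodesicVec F x y ↔ ∀ w : E n,
      dirDeriv (y, (-2 : ℝ) • G) (dirDeriv (0, w) fun x y => F x y ^ 2) x y =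
        dirDeriv (w, 0) (fun x y => F x y ^ 2) x y := by
  have hunit : IsUnit (fundTensor F x y).det := isUnit_iff_ne_zero.2 hdet
  have hbasis : (∀ w : E n,
      dirDeriv (y, (-2 : ℝ) • G) (dirDeriv (0, w) fun x y => F x y ^ 2) x y =
        dirDeriv (w, 0) (fun x y => F x y ^ 2) x y) ↔ ∀ l : Fin n,
      dirDeriv (y, (-2 : ℝ) • G)
        (dirDeriv (0, EuclideanSpace.single l 1) fun x y => F x y ^ 2) x y =
        dirDeriv (EuclideanSpace.single l 1, 0) (fun x y => F x y ^ 2) x y := by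
    refine ⟨fun h l => h _, fun h w => ?_⟩
    rw [dirDeriv_comm hL hp, dirDeriv_eq_sum_snd w, dirDeriv_eq_sum_fst w]
    refine Finset.sum_congr rfl fun i _ => ?_
    rw [dirDeriv_comm hL hp, h]
  have hvec : (∀ l : Fin n, dirDeriv (y, (-2 : ℝ) • G)
        (dirDeriv (0, EuclideanSpace.single l 1) fun x y => F x y ^ 2) x y =
        dirDeriv (EuclideanSpace.single l 1, 0) (fun x y => F x y ^ 2) x y) ↔
      (fundTensor F x y).mulVec G = fun l => 1 / 4 *
      (dirDeriv (y, 0) (dirDeriv (0, EuclideanSpace.single l 1) fun x y => F x y ^ 2) x y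
        - dirDeriv (EuclideanSpace.single l 1, 0) (fun x y => F x y ^ 2) x y) := by
    rw [funext_iff]
    refine forall_congr' fun l => ?_
    rw [fundTensor_mulVec hU hL hp, dirDeriv_split, dirDeriv_snd_smul, smul_eq_mul]
    constructor <;> intro h <;> linarith
  rw [hbasis, hvec]
  constructor
  · rintro rfl
    have : (geodesicVec F x y).ofLp = (fundTensor F x y)⁻¹.mulVec fun l => 1 / 4 *
      (dirDeriv (y, 0) (dirDeriv (0, EuclideanSpace.single l 1) fun x y => F x y ^ 2) x y
        - dirDeriv (EuclideanSpace.single l 1, 0) (fun x y => F x y ^ 2) x y) :=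
      funext fun i => geodesicCoeff_eq hU hL hp i
    rw [this, Matrix.mulVec_mulVec, Matrix.mul_nonsing_inv _ hunit, Matrix.one_mulVec]
  · intro h
    ext i
    change _ = geodesicCoeff F i x y
    rw [geodesicCoeff_eq hU hL hp, ← h, Matrix.mulVec_mulVec, Matrix.nonsing_inv_mul _ hunit,
      Matrix.one_mulVec]

end energy

/-! ### Euler identities for homogeneous functions on the slit tangent bundle. -/

section homogeneous

variable {M : Set (E n)} (hM : IsOpen M)

/-- Euler's identity. -/
theorem dirDeriv_radial {f : E n → E n → ℝ} (hf : SmoothOn (slitTangent M) f) {k : ℕ}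
    (hom : ∀ x ∈ M, ∀ y, ∀ c : ℝ, 0 < c → f x (c • y) = c ^ k * f x y) {x y : E n}
    (hp : (x, y) ∈ slitTangent M) : dirDeriv (0, y) f x y = k * f x y := by
  refine dirDeriv_eq_of_hasDerivAt (hf.differentiableAt hp) ?_
  have h1 : HasDerivAt (fun t : ℝ => (1 + t) ^ k * f x y) (k * f x y) 0 := by
    have := (((hasDerivAt_id (0 : ℝ)).const_add 1).pow k).mul_const (f x y)
    simpa using this
  refine h1.congr_of_eventuallyEq ?_
  filter_upwards [lt_mem_nhds (show (-1 : ℝ) < 0 by norm_num)] with t ht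
  rw [← hom x hp.1 y (1 + t) (by linarith), add_smul, one_smul, smul_zero, add_zero]

include hM

/-- Differentiating Euler's identity. -/
theorem dirDeriv_radial_dirDeriv {f : E n → E n → ℝ} (hf : SmoothOn (slitTangent M) f) {k : ℕ}
    (hom : ∀ x ∈ M, ∀ y, ∀ c : ℝ, 0 < c → f x (c • y) = c ^ k * f x y) {x y : E n}
    (hp : (x, y) ∈ slitTangent M) (v : E n × E n) :
    dirDeriv (0, y) (dirDeriv v f) x y = k * dirDeriv v f x y - dirDeriv (0, v.2) f x y := by
  have hU := isOpen_slitTangent hM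
  have hW : SmoothOn (slitTangent M) fun _ y : E n => ((0 : E n), y) :=
    (SmoothOn.const _ _).prodMk (SmoothOn.snd _)
  have h1 := dirDeriv_field hf hW hp v
  rw [dirDeriv_congr hU (fun _ _ hp => dirDeriv_radial hf hom hp) hp,
    dirDeriv_mul (SmoothOn.const _ _) hf hp, dirDeriv_const,
    dirDeriv_prodMk (SmoothOn.const _ _) (SmoothOn.snd _) hp, dirDeriv_const, dirDeriv_snd,
    dirDeriv_comm hf hp v] at h1
  linarith

end homogeneous

/-! ### Energy conservation, the Riemann endomorphism and flag curvature. -/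

section finsler

variable {M : Set (E n)} {F : E n → E n → ℝ}

theorem IsFinslerMetric.smoothOn (hF : IsFinslerMetric M F) : SmoothOn (slitTangent M) F :=
  fun p hp => hF.smooth p.1 hp.1 p.2 hp.2

theorem IsFinslerMetric.smoothOn_sq (hF : IsFinslerMetric M F) :
    SmoothOn (slitTangent M) fun x y => F x y ^ 2 :=
  fun p hp => (hF.smoothOn p hp).pow 2

theorem IsFinslerMetric.det_ne_zero (hF : IsFinslerMetric M F) (x y : E n)
    (hp : (x, y) ∈ slitTangent M) : (fundTensor F x y).det ≠ 0 :=
  (hF.posDef x hp.1 y hp.2).det_pos.ne'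

theorem IsFinslerMetric.sq_homogeneous (hF : IsFinslerMetric M F) :
    ∀ x ∈ M, ∀ y, ∀ c : ℝ, 0 < c → F x (c • y) ^ 2 = c ^ 2 * F x y ^ 2 := by
  intro x hx y c hc
  rw [hF.homogeneous x hx y c hc, mul_pow]

variable (hM : IsOpen M) (hF : IsFinslerMetric M F)

include hM hF

theorem IsFinslerMetric.smoothOn_geodesicCoeff (i : Fin n) :
    SmoothOn (slitTangent M) (geodesicCoeff F i) :=
  SphSymFinsler.smoothOn_geodesicCoeff (isOpen_slitTangent hM) hF.smoothOn_sq hF.det_ne_zero i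

theorem IsFinslerMetric.smoothOn_geodesicVec : SmoothOn (slitTangent M) (geodesicVec F) :=
  smoothOn_of_apply fun i => hF.smoothOn_geodesicCoeff hM i

theorem IsFinslerMetric.smoothOn_spray :
    SmoothOn (slitTangent M) fun x y => (y, (-2 : ℝ) • geodesicVec F x y) :=
  (SmoothOn.snd _).prodMk ((SmoothOn.const _ _).smul (hF.smoothOn_geodesicVec hM))

theorem IsFinslerMetric.eulerLagrange {x y : E n} (hp : (x, y) ∈ slitTangent M) (w : E n) :
    dirDeriv (y, (-2 : ℝ) • geodesicVec F x y) (dirDeriv (0, w) fun x y => F x y ^ 2) x y =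
      dirDeriv (w, 0) (fun x y => F x y ^ 2) x y :=
  (eulerLagrange_iff (isOpen_slitTangent hM) hF.smoothOn_sq hp (hF.det_ne_zero x y hp) _).1 rfl w

/-- The energy is constant along the spray. -/
theorem IsFinslerMetric.dirDeriv_spray_sq {x y : E n} (hp : (x, y) ∈ slitTangent M) :
    dirDeriv (y, (-2 : ℝ) • geodesicVec F x y) (fun x y => F x y ^ 2) x y = 0 := by
  have h1 := hF.eulerLagrange hM hp y
  rw [dirDeriv_comm hF.smoothOn_sq hp,
    dirDeriv_radial_dirDeriv hM hF.smoothOn_sq hF.sq_homogeneous hp] at h1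
  have h2 := dirDeriv_split y ((-2 : ℝ) • geodesicVec F x y) (fun x y => F x y ^ 2) x y
  push_cast at h1
  linarith

/-- Energy conservation along the spray is an identity on an open set, so it may be differentiated
in any direction `v`. The first term comes from the variation of the spray field itself. -/
theorem IsFinslerMetric.dirDeriv_spray_field {x y : E n} (hp : (x, y) ∈ slitTangent M)
    (v : E n × E n) :
    dirDeriv (v.2, (-2 : ℝ) • dirDeriv v (geodesicVec F) x y) (fun x y => F x y ^ 2) x y +
      dirDeriv (y, (-2 : ℝ) • geodesicVec F x y) (dirDeriv v fun x y => F x y ^ 2) x y = 0 := by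
  have h1 := dirDeriv_field hF.smoothOn_sq (hF.smoothOn_spray hM) hp v
  rw [dirDeriv_congr (isOpen_slitTangent hM) (fun _ _ hp => hF.dirDeriv_spray_sq hM hp) hp,
    dirDeriv_const, dirDeriv_prodMk (SmoothOn.snd _)
      ((SmoothOn.const _ _).smul (hF.smoothOn_geodesicVec hM)) hp, dirDeriv_snd,
    dirDeriv_smul (SmoothOn.const _ _) (hF.smoothOn_geodesicVec hM) hp, dirDeriv_const, zero_smul,
    add_zero, dirDeriv_comm hF.smoothOn_sq hp v] at h1
  rw [dirDeriv_comm hF.smoothOn_sq hp _ v]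
  rw [dirDeriv_comm hF.smoothOn_sq hp _ v] at h1
  exact h1.symm

/-- The energy is constant along horizontal directions. -/
theorem IsFinslerMetric.dirDeriv_horizontal {x y : E n} (hp : (x, y) ∈ slitTangent M) (w : E n) :
    dirDeriv (w, 0) (fun x y => F x y ^ 2) x y =
      dirDeriv (0, dirDeriv (0, w) (geodesicVec F) x y) (fun x y => F x y ^ 2) x y := by
  have h1 := hF.dirDeriv_spray_field hM hp (0, w)
  rw [hF.eulerLagrange hM hp, dirDeriv_split, dirDeriv_snd_smul, smul_eq_mul] at h1
  simp only at h1
  linarith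

/-- The Riemann endomorphism in terms of the spray. -/
theorem IsFinslerMetric.riemannMap_eq {x y : E n} (hp : (x, y) ∈ slitTangent M) (u : E n) :
    riemannMap F x y u = (2 : ℝ) • dirDeriv (u, 0) (geodesicVec F) x y
      - dirDeriv (y, (-2 : ℝ) • geodesicVec F x y) (dirDeriv (0, u) (geodesicVec F)) x y
      - dirDeriv (0, dirDeriv (0, u) (geodesicVec F) x y) (geodesicVec F) x y := by
  have hU := isOpen_slitTangent hM
  have hG := hF.smoothOn_geodesicVec hM
  have hGi := hF.smoothOn_geodesicCoeff hM
  have hap : ∀ v i, dirDeriv v (geodesicVec F) x y i = dirDeriv v (geodesicCoeff F i) x y :=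
    fun v i => (dirDeriv_apply hG hp v i).symm
  ext i
  have h2 : dirDeriv (y, (-2 : ℝ) • geodesicVec F x y) (dirDeriv (0, u) (geodesicVec F)) x y i =
      ∑ k, u k * dirDeriv (y, (-2 : ℝ) • geodesicVec F x y)
        (dirDeriv (0, EuclideanSpace.single k 1) (geodesicCoeff F i)) x y := by
    rw [← dirDeriv_apply (hG.dirDeriv _) hp]
    rw [dirDeriv_congr hU (fun x y hp => (dirDeriv_apply hG hp (0, u) i).symm) hp]
    change dirDeriv _ (dirDeriv (0, u) (geodesicCoeff F i)) x y = _
    rw [dirDeriv_comm (hGi i) hp, dirDeriv_eq_sum_snd u]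
    refine Finset.sum_congr rfl fun k _ => ?_
    rw [dirDeriv_comm (hGi i) hp, smul_eq_mul]
  have h3 : dirDeriv (0, dirDeriv (0, u) (geodesicVec F) x y) (geodesicVec F) x y i =
      ∑ k, u k * ∑ j, dirDeriv (0, EuclideanSpace.single j 1) (geodesicCoeff F i) x y *
        dirDeriv (0, EuclideanSpace.single k 1) (geodesicCoeff F j) x y := by
    rw [hap, dirDeriv_eq_sum_snd]
    simp only [hap (0, u), smul_eq_mul]
    simp only [dirDeriv_eq_sum_snd u, smul_eq_mul, Finset.mul_sum, Finset.sum_mul]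
    rw [Finset.sum_comm]
    refine Finset.sum_congr rfl fun k _ => Finset.sum_congr rfl fun j _ => by ring
  simp only [PiLp.sub_apply, PiLp.smul_apply, smul_eq_mul, h2, h3, hap]
  rw [dirDeriv_eq_sum_fst u]
  simp only [riemannMap, riemannCurvature, smul_eq_mul]
  rw [Finset.mul_sum, ← Finset.sum_sub_distrib, ← Finset.sum_sub_distrib]
  refine Finset.sum_congr rfl fun k _ => ?_
  simp only [partialX_eq (hGi _) hp, partialY_eq (hGi _) hp, partialX_partialY_eq hU (hGi _) hp,
    partialY_partialY_eq hU (hGi _) hp]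
  rw [dirDeriv_split y, dirDeriv_snd_smul, dirDeriv_eq_sum_fst y,
    dirDeriv_eq_sum_snd (geodesicVec F x y)]
  simp only [geodesicVec, smul_eq_mul]
  ring

/-- The Riemann endomorphism takes values orthogonal to `y`. -/
theorem IsFinslerMetric.dirDeriv_riemannMap {x y : E n} (hp : (x, y) ∈ slitTangent M) (u : E n) :
    dirDeriv (0, riemannMap F x y u) (fun x y => F x y ^ 2) x y = 0 := by
  have hG := hF.smoothOn_geodesicVec hM
  -- With E = F² and N_u the derivative of G in the vertical direction u, the horizontal identity
  -- E_{x^u} = dE(0, N_u) is differentiated along the spray. The Euler–Lagrange equation turns the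
  -- second-order term into dE(0, N_{N_u}), and `h2` supplies the derivative of E_{x^u} along the
  -- spray; together they contain the three terms of R_y(u).
  have h1 := dirDeriv_field hF.smoothOn_sq
    (W := fun x y => (0, dirDeriv (0, u) (geodesicVec F) x y))
    ((SmoothOn.const _ _).prodMk (hG.dirDeriv _)) hp (y, (-2 : ℝ) • geodesicVec F x y)
  rw [← dirDeriv_congr (isOpen_slitTangent hM) (fun _ _ hp => hF.dirDeriv_horizontal hM hp u) hp,
    hF.eulerLagrange hM hp, dirDeriv_prodMk (SmoothOn.const _ _) (hG.dirDeriv _) hp,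
    dirDeriv_const, hF.dirDeriv_horizontal hM hp] at h1
  have h2 := hF.dirDeriv_spray_field hM hp (u, 0)
  rw [dirDeriv_snd_smul] at h2
  rw [hF.riemannMap_eq hM hp, sub_eq_add_neg, sub_eq_add_neg, dirDeriv_snd_add, dirDeriv_snd_add,
    ← neg_one_smul ℝ, ← neg_one_smul ℝ (dirDeriv (0, _) _ _ _)]
  simp only [dirDeriv_snd_smul, smul_eq_mul] at h2 ⊢
  linarith

theorem IsFinslerMetric.fundInner_self {x y : E n} (hp : (x, y) ∈ slitTangent M) (v : E n) :
    fundInner F x y y v = 1 / 2 * dirDeriv (0, v) (fun x y => F x y ^ 2) x y := by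
  rw [fundInner_eq (isOpen_slitTangent hM) hF.smoothOn_sq hp,
    dirDeriv_radial_dirDeriv hM hF.smoothOn_sq hF.sq_homogeneous hp]
  push_cast
  ring

theorem IsFinslerMetric.fundInner_self_self {x y : E n} (hp : (x, y) ∈ slitTangent M) :
    fundInner F x y y y = F x y ^ 2 := by
  rw [hF.fundInner_self hM hp, dirDeriv_radial hF.smoothOn_sq hF.sq_homogeneous hp]
  push_cast
  ring

omit hM in
theorem IsFinslerMetric.fundInner_pos {x y : E n} (hp : (x, y) ∈ slitTangent M) {u : E n}
    (hu : u ≠ 0) : 0 < fundInner F x y u u := by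
  have h := (hF.posDef x hp.1 y hp.2).dotProduct_mulVec_pos (x := u.ofLp)
    (fun h => hu (by ext i; simp [h]))
  refine h.trans_eq ?_
  simp only [fundInner, dotProduct, Matrix.mulVec, Finset.mul_sum]
  refine Finset.sum_congr rfl fun i _ => Finset.sum_congr rfl fun j _ => ?_
  simp
  ring

theorem IsFinslerMetric.sq_pos {x y : E n} (hp : (x, y) ∈ slitTangent M) : 0 < F x y ^ 2 := by
  rw [← hF.fundInner_self_self hM hp]
  exact hF.fundInner_pos hp hp.2

omit hF in
theorem fundInner_bilin (hL : SmoothOn (slitTangent M) fun x y => F x y ^ 2) {x y : E n}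
    (hp : (x, y) ∈ slitTangent M) (a b : ℝ) (u v w : E n) :
    fundInner F x y (a • u + b • v) w = a * fundInner F x y u w + b * fundInner F x y v w := by
  have hU := isOpen_slitTangent hM
  simp only [fundInner_eq hU hL hp, dirDeriv_snd_add, dirDeriv_snd_smul, smul_eq_mul]
  ring

omit hF in
theorem fundInner_comm (hL : SmoothOn (slitTangent M) fun x y => F x y ^ 2) {x y : E n}
    (hp : (x, y) ∈ slitTangent M) (u v : E n) :
    fundInner F x y u v = fundInner F x y v u := by
  have hU := isOpen_slitTangent hM
  simp only [fundInner_eq hU hL hp, dirDeriv_comm hL hp (0, u)]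

/-- The denominator of the flag curvature is positive. -/
theorem IsFinslerMetric.gram_pos {x y : E n} (hp : (x, y) ∈ slitTangent M) {u : E n}
    (hu : LinearIndependent ℝ ![y, u]) :
    0 < fundInner F x y y y * fundInner F x y u u - fundInner F x y y u ^ 2 := by
  have hL := hF.smoothOn_sq
  have hyy : 0 < fundInner F x y y y := hF.fundInner_pos hp hp.2
  -- Gram–Schmidt: u − cy is the component of u orthogonal to y, and g_y(y,y) times its squared
  -- length is the Gram determinant.
  set c := fundInner F x y y u / fundInner F x y y y with hc
  have hne : (1 : ℝ) • u + (-c) • y ≠ 0 := by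
    intro h
    rw [LinearIndependent.pair_iff] at hu
    have := hu (-c) 1 (by rw [add_comm]; exact h)
    exact one_ne_zero this.2
  have h := hF.fundInner_pos hp hne
  rw [fundInner_bilin hM hL hp, fundInner_comm hM hL hp u, fundInner_comm hM hL hp y,
    fundInner_bilin hM hL hp, fundInner_bilin hM hL hp, fundInner_comm hM hL hp u y] at h
  have h2 : c * fundInner F x y y y = fundInner F x y y u := by
    rw [hc]; field_simp
  have h3 := mul_pos hyy h
  nlinarith

/-- A metric whose Riemann endomorphism is a multiple of the identity modulo `y` has a flag
curvature independent of the flag. -/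
theorem IsFinslerMetric.flagCurvature_eq {x y : E n} (hp : (x, y) ∈ slitTangent M) {μ : ℝ}
    (hR : ∀ u, ∃ τ : ℝ, riemannMap F x y u = μ • u + τ • y) {u : E n}
    (hu : LinearIndependent ℝ ![y, u]) : flagCurvature F x y u = μ / F x y ^ 2 := by
  have hL := hF.smoothOn_sq
  obtain ⟨τ, hτ⟩ := hR u
  -- Orthogonality to y fixes τ: it gives μ g_y(y,u) + τF² = 0, so the numerator of the flag
  -- curvature is μ/F² times the Gram determinant.
  have h0 : fundInner F x y y (riemannMap F x y u) = 0 := by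
    rw [hF.fundInner_self hM hp, hF.dirDeriv_riemannMap hM hp, mul_zero]
  have hg := hF.gram_pos hM hp hu
  have hF2 := hF.sq_pos hM hp
  rw [fundInner_comm hM hL hp, hτ, fundInner_bilin hM hL hp, fundInner_comm hM hL hp u y,
    hF.fundInner_self_self hM hp] at h0
  rw [flagCurvature, hτ, fundInner_bilin hM hL hp]
  rw [hF.fundInner_self_self hM hp] at hg ⊢
  rw [div_eq_div_iff hg.ne' hF2.ne']
  linear_combination (fundInner F x y y u) * h0

end finsler

/-! ### Radial coefficients -/

/-- Radial coefficients on an open set `J` of positive radii, with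
`q = (g' + 2 r g²) / (r (1 - 2 r² g))`, and the differential equations satisfied by `T` and
`T̄`. -/
structure RadialData (J : Set ℝ) (g q h T Tb : ℝ → ℝ) : Prop where
  isOpen : IsOpen J
  pos : ∀ r ∈ J, 0 < r
  smooth_g : ∀ r ∈ J, ContDiffAt ℝ ∞ g r
  smooth_q : ∀ r ∈ J, ContDiffAt ℝ ∞ q r
  smooth_h : ∀ r ∈ J, ContDiffAt ℝ ∞ h r
  smooth_T : ∀ r ∈ J, ContDiffAt ℝ ∞ T r
  smooth_Tb : ∀ r ∈ J, ContDiffAt ℝ ∞ Tb r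
  hasDerivAt_g : ∀ r ∈ J,
    HasDerivAt g (r * q r * (1 - 2 * r ^ 2 * g r) - 2 * r * g r ^ 2) r
  hasDerivAt_T : ∀ r ∈ J, HasDerivAt T (4 * r * (g r + q r * r ^ 2) * T r) r
  hasDerivAt_Tb : ∀ r ∈ J, HasDerivAt Tb (4 * r * q r * T r) r
  disc_pos : ∀ r ∈ J, ∀ s : ℝ, |s| ≤ r → 0 < T r - Tb r * (r ^ 2 - s ^ 2)

theorem RadialData.hasDerivAt_h {J : Set ℝ} {g q h T Tb : ℝ → ℝ} (D : RadialData J g q h T Tb)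
    {r : ℝ} (hr : r ∈ J) : HasDerivAt h (deriv h r) r :=
  ((D.smooth_h r hr).differentiableAt (by simp)).hasDerivAt

/-- The positivity assumption is used at its two ends: s = 0 gives T − r²T̄ > 0, and s = r gives T >
0 in the next lemma. -/
theorem RadialData.sub_pos {J : Set ℝ} {g q h T Tb : ℝ → ℝ} (D : RadialData J g q h T Tb)
    {r : ℝ} (hr : r ∈ J) : 0 < T r - r ^ 2 * Tb r := by
  have := D.disc_pos r hr 0 (by simpa using (D.pos r hr).le)
  nlinarith

theorem RadialData.T_pos {J : Set ℝ} {g q h T Tb : ℝ → ℝ} (D : RadialData J g q h T Tb)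
    {r : ℝ} (hr : r ∈ J) : 0 < T r := by
  have := D.disc_pos r hr r (abs_of_pos (D.pos r hr)).le
  simpa using this

theorem isOpen_radialDomain {J : Set ℝ} (hJ : IsOpen J) : IsOpen (radialDomain n J) :=
  hJ.preimage continuous_norm

/-- The square of the Riemannian norm with the same unparametrized geodesics. -/
noncomputable def alphaSq (T Tb : ℝ → ℝ) (x y : E n) : ℝ :=
  (T ‖x‖ - ‖x‖ ^ 2 * Tb ‖x‖) * ‖y‖ ^ 2 + Tb ‖x‖ * inner ℝ x y ^ 2

theorem inner_sq_le (x y : E n) : inner ℝ x y ^ 2 ≤ ‖x‖ ^ 2 * ‖y‖ ^ 2 := by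
  rw [← mul_pow, sq_le_sq, abs_of_nonneg (by positivity : 0 ≤ ‖x‖ * ‖y‖)]
  exact abs_real_inner_le_norm x y

theorem abs_inner_div_norm_le (x y : E n) : |inner ℝ x y / ‖y‖| ≤ ‖x‖ := by
  rw [abs_div, abs_norm]
  exact div_le_of_le_mul₀ (norm_nonneg _) (norm_nonneg _) (abs_real_inner_le_norm x y)

theorem alphaSq_eq (T Tb : ℝ → ℝ) (x : E n) {y : E n} (hy : y ≠ 0) :
    alphaSq T Tb x y =
      ‖y‖ ^ 2 * (T ‖x‖ - Tb ‖x‖ * (‖x‖ ^ 2 - (inner ℝ x y / ‖y‖) ^ 2)) := by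
  have := norm_ne_zero_iff.2 hy
  rw [alphaSq]
  field_simp
  ring

theorem RadialData.alphaSq_pos {J : Set ℝ} {g q h T Tb : ℝ → ℝ} (D : RadialData J g q h T Tb)
    {x y : E n} (hx : ‖x‖ ∈ J) (hy : y ≠ 0) : 0 < alphaSq T Tb x y := by
  rw [alphaSq_eq T Tb x hy]
  exact mul_pos (by positivity) (D.disc_pos _ hx _ (abs_inner_div_norm_le x y))

/-- The explicit metric in terms of the Riemannian norm. -/
theorem explicitMetric_eq (h T Tb : ℝ → ℝ) (γ ε : ℝ) (x : E n) {y : E n} (hy : y ≠ 0) :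
    explicitMetric n h T Tb γ ε x y = h ‖x‖ * inner ℝ x y
      + ε * (√(alphaSq T Tb x y) / (T ‖x‖ - ‖x‖ ^ 2 * Tb ‖x‖))
      + γ * (‖x‖ ^ 2 * √(alphaSq T Tb x y) / (T ‖x‖ - ‖x‖ ^ 2 * Tb ‖x‖) ^ 2
        + T ‖x‖ * inner ℝ x y ^ 2
          / ((T ‖x‖ - ‖x‖ ^ 2 * Tb ‖x‖) ^ 2 * √(alphaSq T Tb x y))) := by
  have hy' := norm_ne_zero_iff.2 hy
  rw [alphaSq_eq T Tb x hy, Real.sqrt_mul (by positivity), Real.sqrt_sq (norm_nonneg y)]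
  simp only [explicitMetric, sphMetric, phi]
  generalize √(T ‖x‖ - Tb ‖x‖ * (‖x‖ ^ 2 - (inner ℝ x y / ‖y‖) ^ 2)) = d
  generalize T ‖x‖ - ‖x‖ ^ 2 * Tb ‖x‖ = c
  -- No positivity is assumed here, so a vanishing root or a vanishing denominator is treated
  -- separately; the convention that division by zero is zero makes both sides agree.
  rcases eq_or_ne d 0 with rfl | hd
  · simp only [mul_zero, zero_div, div_zero, add_zero]
    field_simp
  rcases eq_or_ne c 0 with rfl | hc
  · simp only [mul_zero, zero_mul, ne_eq, OfNat.ofNat_ne_zero, not_false_eq_true, zero_pow,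
      div_zero, add_zero]
    field_simp
  field_simp
  ring

/-! ### Derivatives along lines -/

section lines

variable {x y : E n} (a b : E n)

theorem hasDerivAt_norm_line (hx : x ≠ 0) :
    HasDerivAt (fun t : ℝ => ‖x + t • a‖) (inner ℝ x a / ‖x‖) 0 := by
  have hl : HasDerivAt (fun t : ℝ => x + t • a) a 0 := by
    simpa using ((hasDerivAt_id (0 : ℝ)).smul_const a).const_add x
  have h1 : HasDerivAt (fun t : ℝ => ‖x + t • a‖ ^ 2) (2 * inner ℝ x a) 0 := by
    simpa using hl.norm_sq
  have h2 := h1.sqrt (by simpa using hx)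
  simp only [Real.sqrt_sq (norm_nonneg _), zero_smul, add_zero] at h2
  convert h2 using 1
  rw [mul_div_mul_left _ _ two_ne_zero]

theorem hasDerivAt_radial_line (hx : x ≠ 0) {ρ : ℝ → ℝ} {ρ' : ℝ} (hρ : HasDerivAt ρ ρ' ‖x‖) :
    HasDerivAt (fun t : ℝ => ρ ‖x + t • a‖) (ρ' * (inner ℝ x a / ‖x‖)) 0 := by
  have h := hasDerivAt_norm_line a hx
  have hρ' : HasDerivAt ρ ρ' ((fun t : ℝ => ‖x + t • a‖) 0) := by simpa using hρ
  exact hρ'.comp (0 : ℝ) h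

theorem hasDerivAt_inner_line :
    HasDerivAt (fun t : ℝ => inner ℝ (x + t • a) (y + t • b)) (inner ℝ a y + inner ℝ x b) 0 := by
  have hl : HasDerivAt (fun t : ℝ => x + t • a) a 0 := by
    simpa using ((hasDerivAt_id (0 : ℝ)).smul_const a).const_add x
  have hl' : HasDerivAt (fun t : ℝ => y + t • b) b 0 := by
    simpa using ((hasDerivAt_id (0 : ℝ)).smul_const b).const_add y
  simpa [add_comm] using hl.inner ℝ hl'

theorem hasDerivAt_inner_const_line (w : E n) :
    HasDerivAt (fun t : ℝ => inner ℝ (x + t • a) w) (inner ℝ a w) 0 := by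
  simpa using hasDerivAt_inner_line (x := x) (y := w) a 0

theorem hasDerivAt_normSq_line :
    HasDerivAt (fun t : ℝ => ‖x + t • a‖ ^ 2) (2 * inner ℝ x a) 0 := by
  have hl : HasDerivAt (fun t : ℝ => x + t • a) a 0 := by
    simpa using ((hasDerivAt_id (0 : ℝ)).smul_const a).const_add x
  simpa using hl.norm_sq

end lines

theorem smoothOn_radial {J : Set ℝ} (hJ : ∀ r ∈ J, 0 < r) {ρ : ℝ → ℝ}
    (hρ : ∀ r ∈ J, ContDiffAt ℝ ∞ ρ r) :
    SmoothOn (slitTangent (radialDomain n J)) fun x _ => ρ ‖x‖ := by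
  intro p hp
  have hx : p.1 ≠ 0 := norm_pos_iff.1 (hJ _ hp.1)
  have h1 : ContDiffAt ℝ ∞ (fun p : E n × E n => ‖p.1‖) p := contDiffAt_fst.norm ℝ hx
  exact ContDiffAt.comp (g := ρ) p (hρ _ hp.1) h1

theorem smoothOn_inner (U : Set (E n × E n)) : SmoothOn U fun x y => inner ℝ x y :=
  fun _ _ => contDiffAt_fst.inner ℝ contDiffAt_snd

theorem smoothOn_normSq (U : Set (E n × E n)) : SmoothOn U fun _ y => ‖y‖ ^ 2 :=
  fun _ _ => contDiffAt_snd.norm_sq ℝ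

theorem smoothOn_inner_fst (U : Set (E n × E n)) (w : E n) : SmoothOn U fun x _ => inner ℝ x w :=
  fun _ _ => contDiffAt_fst.inner ℝ contDiffAt_const

theorem smoothOn_inner_snd (U : Set (E n × E n)) (w : E n) : SmoothOn U fun _ y => inner ℝ y w :=
  fun _ _ => contDiffAt_snd.inner ℝ contDiffAt_const

theorem SmoothOn.pow {U : Set (E n × E n)} {f : E n → E n → ℝ} (hf : SmoothOn U f) (k : ℕ) :
    SmoothOn U fun x y => f x y ^ k := fun p hp => (hf p hp).pow k

section explicit

variable {J : Set ℝ} {g q h T Tb : ℝ → ℝ} (D : RadialData J g q h T Tb)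

include D

theorem RadialData.isOpen_slitTangent : IsOpen (slitTangent (radialDomain n J)) :=
  SphSymFinsler.isOpen_slitTangent (isOpen_radialDomain D.isOpen)

theorem RadialData.ne_zero {x : E n} (hx : ‖x‖ ∈ J) : x ≠ 0 := norm_pos_iff.1 (D.pos _ hx)

theorem RadialData.smooth_c : ∀ r ∈ J, ContDiffAt ℝ ∞ (fun r => T r - r ^ 2 * Tb r) r :=
  fun r hr => (D.smooth_T r hr).sub ((contDiffAt_id.pow 2).mul (D.smooth_Tb r hr))

theorem RadialData.hasDerivAt_c {r : ℝ} (hr : r ∈ J) :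
    HasDerivAt (fun r => T r - r ^ 2 * Tb r) (4 * r * g r * T r - 2 * r * Tb r) r := by
  refine ((D.hasDerivAt_T r hr).sub
    (((hasDerivAt_id r).pow 2).mul (D.hasDerivAt_Tb r hr))).congr_deriv ?_
  simp
  ring

theorem RadialData.smoothOn_sqrt_alphaSq :
    SmoothOn (slitTangent (radialDomain n J)) fun x y => √(alphaSq T Tb x y) := by
  have h1 : SmoothOn (slitTangent (radialDomain n J)) (alphaSq (n := n) T Tb) :=
    ((smoothOn_radial D.pos D.smooth_c).mul (smoothOn_normSq _)).add
      ((smoothOn_radial D.pos D.smooth_Tb).mul ((smoothOn_inner _).pow 2))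
  exact fun p hp => (h1 p hp).sqrt (D.alphaSq_pos hp.1 hp.2).ne'

theorem RadialData.sqrt_alphaSq_pos {x y : E n} (hp : (x, y) ∈ slitTangent (radialDomain n J)) :
    0 < √(alphaSq T Tb x y) := Real.sqrt_pos.2 (D.alphaSq_pos hp.1 hp.2)

/-- The derivative of the Riemannian norm along a line. -/
theorem RadialData.hasDerivAt_sqrt_alphaSq_line {x y : E n}
    (hp : (x, y) ∈ slitTangent (radialDomain n J)) (a b : E n) :
    HasDerivAt (fun t : ℝ => √(alphaSq T Tb (x + t • a) (y + t • b)))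
      (((4 * g ‖x‖ * T ‖x‖ - 2 * Tb ‖x‖) * inner ℝ x a * ‖y‖ ^ 2
        + (T ‖x‖ - ‖x‖ ^ 2 * Tb ‖x‖) * (2 * inner ℝ y b)
        + 4 * q ‖x‖ * T ‖x‖ * inner ℝ x a * inner ℝ x y ^ 2
        + Tb ‖x‖ * (2 * inner ℝ x y * (inner ℝ a y + inner ℝ x b)))
        / (2 * √(alphaSq T Tb x y))) 0 := by
  have hJ : ‖x‖ ∈ J := hp.1
  have hx := D.ne_zero hJ
  have hr := norm_ne_zero_iff.2 hx
  have h1 := (hasDerivAt_radial_line a hx (D.hasDerivAt_c hJ)).mul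
    (hasDerivAt_normSq_line (x := y) b)
  have h2 := (hasDerivAt_radial_line a hx (D.hasDerivAt_Tb _ hJ)).mul
    ((hasDerivAt_inner_line (x := x) (y := y) a b).pow 2)
  have h3 := (h1.add h2).sqrt (by simpa [alphaSq] using (D.alphaSq_pos hJ hp.2).ne')
  refine h3.congr_deriv ?_
  simp only [zero_smul, add_zero, Pi.add_apply, Pi.mul_apply, Pi.pow_apply, alphaSq]
  congr 1
  push_cast
  field_simp
  ring

end explicit

/-! ### First derivatives of the explicit metric -/

/-- The explicit metric in terms of the Riemannian norm. -/
noncomputable def explicitForm (h T Tb : ℝ → ℝ) (γ ε : ℝ) (x y : E n) : ℝ :=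
  h ‖x‖ * inner ℝ x y
    + ε * (√(alphaSq T Tb x y) / (T ‖x‖ - ‖x‖ ^ 2 * Tb ‖x‖))
    + γ * (‖x‖ ^ 2 * √(alphaSq T Tb x y) / (T ‖x‖ - ‖x‖ ^ 2 * Tb ‖x‖) ^ 2
      + T ‖x‖ * inner ℝ x y ^ 2
        / ((T ‖x‖ - ‖x‖ ^ 2 * Tb ‖x‖) ^ 2 * √(alphaSq T Tb x y)))

/-- The derivative of the explicit metric with respect to `⟨x, y⟩`. -/
noncomputable def formDerivInner (h T Tb : ℝ → ℝ) (γ ε : ℝ) (x y : E n) : ℝ :=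
  h ‖x‖ + inner ℝ x y *
    (ε * (Tb ‖x‖ / ((T ‖x‖ - ‖x‖ ^ 2 * Tb ‖x‖) * √(alphaSq T Tb x y)))
      + γ * ((‖x‖ ^ 2 * Tb ‖x‖ + 2 * T ‖x‖)
          / ((T ‖x‖ - ‖x‖ ^ 2 * Tb ‖x‖) ^ 2 * √(alphaSq T Tb x y))
        - T ‖x‖ * Tb ‖x‖ * inner ℝ x y ^ 2
          / ((T ‖x‖ - ‖x‖ ^ 2 * Tb ‖x‖) ^ 2 * √(alphaSq T Tb x y) ^ 3)))

/-- Twice the derivative of the explicit metric with respect to `|y|²`. -/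
noncomputable def formDerivNormSq (T Tb : ℝ → ℝ) (γ ε : ℝ) (x y : E n) : ℝ :=
  ε / √(alphaSq T Tb x y)
    + γ * (‖y‖ ^ 2 * ‖x‖ ^ 2 - inner ℝ x y ^ 2) / √(alphaSq T Tb x y) ^ 3

/-- The radial derivative of the explicit metric, divided by the radius. -/
noncomputable def formDerivRadial (g q h T Tb : ℝ → ℝ) (γ ε : ℝ) (x y : E n) : ℝ :=
  let r := ‖x‖
  let b : ℝ := inner ℝ x y
  let c := T r - r ^ 2 * Tb r
  let α := √(alphaSq T Tb x y)
  let α' := ((2 * g r * T r - Tb r) * ‖y‖ ^ 2 + 2 * q r * T r * b ^ 2) / α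
  let c' := 4 * g r * T r - 2 * Tb r
  let T' := 4 * (g r + q r * r ^ 2) * T r
  deriv h r * b / r + ε * (α' / c - α * c' / c ^ 2)
    + γ * (2 * α / c ^ 2 + r ^ 2 * α' / c ^ 2 - 2 * r ^ 2 * α * c' / c ^ 3
      + T' * b ^ 2 / (c ^ 2 * α) - 2 * T r * b ^ 2 * c' / (c ^ 3 * α)
      - T r * b ^ 2 * α' / (c ^ 2 * α ^ 2))

section explicit

variable {J : Set ℝ} {g q h T Tb : ℝ → ℝ} (D : RadialData J g q h T Tb) (γ ε : ℝ)

include D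

theorem RadialData.smoothOn_explicitForm :
    SmoothOn (slitTangent (radialDomain n J)) (explicitForm h T Tb γ ε) := by
  have hα := D.smoothOn_sqrt_alphaSq (n := n)
  have hc := smoothOn_radial (n := n) D.pos D.smooth_c
  have hr := smoothOn_radial (n := n) D.pos (ρ := id) fun _ _ => contDiffAt_id
  have hT := smoothOn_radial (n := n) D.pos D.smooth_T
  have hh := smoothOn_radial (n := n) D.pos D.smooth_h
  have hb := smoothOn_inner (slitTangent (radialDomain n J))
  have hc0 : ∀ x y : E n, (x, y) ∈ slitTangent (radialDomain n J) →
      T ‖x‖ - ‖x‖ ^ 2 * Tb ‖x‖ ≠ 0 := fun x y hp => (D.sub_pos hp.1).ne'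
  have hα0 : ∀ x y : E n, (x, y) ∈ slitTangent (radialDomain n J) →
      √(alphaSq T Tb x y) ≠ 0 := fun x y hp => (D.sqrt_alphaSq_pos hp).ne'
  refine ((hh.mul hb).add ((SmoothOn.const _ ε).mul (hα.div hc hc0))).add
    ((SmoothOn.const _ γ).mul ((((hr.pow 2).mul hα).div (hc.pow 2) ?_).add
      ((hT.mul (hb.pow 2)).div ((hc.pow 2).mul hα) ?_)))
  · exact fun x y hp => pow_ne_zero _ (hc0 x y hp)
  · exact fun x y hp => mul_ne_zero (pow_ne_zero _ (hc0 x y hp)) (hα0 x y hp)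

theorem RadialData.smoothOn_explicitMetric :
    SmoothOn (slitTangent (radialDomain n J)) (explicitMetric n h T Tb γ ε) :=
  (D.smoothOn_explicitForm γ ε).congr D.isOpen_slitTangent
    fun x _ hp => explicitMetric_eq h T Tb γ ε x hp.2

theorem RadialData.sq_sqrt_alphaSq {x y : E n} (hp : (x, y) ∈ slitTangent (radialDomain n J)) :
    √(alphaSq T Tb x y) ^ 2 =
      (T ‖x‖ - ‖x‖ ^ 2 * Tb ‖x‖) * ‖y‖ ^ 2 + Tb ‖x‖ * inner ℝ x y ^ 2 := by
  rw [Real.sq_sqrt (D.alphaSq_pos hp.1 hp.2).le, alphaSq]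

/-- F depends on (x, y) only through |x|, ⟨x,y⟩ and |y|², so the chain rule gives three terms, one
for each of these quantities. -/
theorem RadialData.dirDeriv_explicitMetric {x y : E n}
    (hp : (x, y) ∈ slitTangent (radialDomain n J)) (v w : E n) :
    dirDeriv (v, w) (explicitMetric n h T Tb γ ε) x y =
      formDerivRadial g q h T Tb γ ε x y * inner ℝ x v
        + formDerivInner h T Tb γ ε x y * (inner ℝ v y + inner ℝ x w)
        + formDerivNormSq T Tb γ ε x y * inner ℝ y w := by
  have hJ : ‖x‖ ∈ J := hp.1
  have hx := D.ne_zero hJ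
  have hr := norm_ne_zero_iff.2 hx
  have hc := (D.sub_pos hJ).ne'
  have hα := (D.sqrt_alphaSq_pos hp).ne'
  have hsq := D.sq_sqrt_alphaSq hp
  rw [dirDeriv_congr D.isOpen_slitTangent
    (fun x _ hp => explicitMetric_eq h T Tb γ ε x hp.2) hp]
  refine dirDeriv_eq_of_hasDerivAt ((D.smoothOn_explicitForm γ ε).differentiableAt hp) ?_
  have dα := D.hasDerivAt_sqrt_alphaSq_line hp v w
  have dc := hasDerivAt_radial_line v hx (D.hasDerivAt_c hJ)
  have dT := hasDerivAt_radial_line v hx (D.hasDerivAt_T _ hJ)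
  have dh := hasDerivAt_radial_line v hx (D.hasDerivAt_h hJ)
  have dr := hasDerivAt_norm_line v hx
  have db := hasDerivAt_inner_line (x := x) (y := y) v w
  have main := ((dh.mul db).add ((dα.div dc (by simpa using hc)).const_mul ε)).add
    (((((dr.pow 2).mul dα).div (dc.pow 2) (by simpa using pow_ne_zero 2 hc)).add
      ((dT.mul (db.pow 2)).div ((dc.pow 2).mul dα)
        (by simpa using ⟨hc, hα⟩))).const_mul γ)
  refine main.congr_deriv ?_
  simp only [zero_smul, add_zero, Pi.mul_apply, Pi.pow_apply, formDerivRadial,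
    formDerivInner, formDerivNormSq]
  clear main dα dc dT dh dr db
  generalize hcc : T ‖x‖ - ‖x‖ ^ 2 * Tb ‖x‖ = c at *
  have hT : T ‖x‖ = c + ‖x‖ ^ 2 * Tb ‖x‖ := by rw [← hcc]; ring
  -- Eliminating |y|² and T in favour of α and c removes the algebraic relation defining α. What
  -- remains is an identity of rational functions in independent variables.
  have he : ‖y‖ ^ 2 = (√(alphaSq T Tb x y) ^ 2 - Tb ‖x‖ * inner ℝ x y ^ 2) / c := by
    rw [hsq]; field_simp; ring
  simp only [he, hT]
  generalize √(alphaSq T Tb x y) = α at *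
  generalize Tb ‖x‖ = K at *
  generalize ‖x‖ = r at *
  push_cast
  field_simp
  ring

end explicit

/-! ### The spray of the explicit metric -/

/-- The coefficient of `x` in the spray. -/
noncomputable def sprayCoeff (g q : ℝ → ℝ) (x y : E n) : ℝ :=
  g ‖x‖ * ‖y‖ ^ 2 + q ‖x‖ * inner ℝ x y ^ 2

section explicit

variable {J : Set ℝ} {g q h T Tb : ℝ → ℝ} (D : RadialData J g q h T Tb)

include D

theorem RadialData.smoothOn_sprayCoeff :
    SmoothOn (slitTangent (radialDomain n J)) (sprayCoeff (n := n) g q) :=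
  ((smoothOn_radial D.pos D.smooth_g).mul (smoothOn_normSq _)).add
    ((smoothOn_radial D.pos D.smooth_q).mul ((smoothOn_inner _).pow 2))

/-- The Riemannian norm is constant along the spray. -/
theorem RadialData.hasDerivAt_sqrt_alphaSq_spray {x y : E n}
    (hp : (x, y) ∈ slitTangent (radialDomain n J)) :
    HasDerivAt (fun t : ℝ => √(alphaSq T Tb (x + t • y) (y + t • (-2 * sprayCoeff g q x y) • x)))
      0 0 := by
  refine (D.hasDerivAt_sqrt_alphaSq_line hp _ _).congr_deriv ?_
  rw [div_eq_zero_iff]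
  left
  -- The numerator reduces to 4Tb(g|y|² + qb²) − 4Qb(c + r²T̄), which is zero because c + r²T̄ = T.
  simp only [inner_smul_right, real_inner_self_eq_norm_sq, sprayCoeff, real_inner_comm x y]
  ring

theorem RadialData.smoothOn_formDeriv (γ ε : ℝ) (w : E n) :
    SmoothOn (slitTangent (radialDomain n J)) fun x y =>
      formDerivInner h T Tb γ ε x y * inner ℝ x w + formDerivNormSq T Tb γ ε x y * inner ℝ y w := by
  refine ((D.smoothOn_explicitMetric γ ε).dirDeriv (0, w)).congr D.isOpen_slitTangent
    fun x y hp => ?_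
  rw [D.dirDeriv_explicitMetric γ ε hp]
  simp

/-- The paths of the spray are extremals of the explicit metric. -/
theorem RadialData.dirDeriv_spray_dirDeriv (γ ε : ℝ) {x y : E n}
    (hp : (x, y) ∈ slitTangent (radialDomain n J)) (w : E n) :
    dirDeriv (y, (-2 * sprayCoeff g q x y) • x)
      (dirDeriv (0, w) (explicitMetric n h T Tb γ ε)) x y =
      dirDeriv (w, 0) (explicitMetric n h T Tb γ ε) x y := by
  have hJ : ‖x‖ ∈ J := hp.1
  have hx := D.ne_zero hJ
  have hr := norm_ne_zero_iff.2 hx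
  have hc := (D.sub_pos hJ).ne'
  have hα := (D.sqrt_alphaSq_pos hp).ne'
  have hsq := D.sq_sqrt_alphaSq hp
  rw [dirDeriv_congr (g := fun x y =>
      formDerivInner h T Tb γ ε x y * inner ℝ x w + formDerivNormSq T Tb γ ε x y * inner ℝ y w)
    D.isOpen_slitTangent
    (fun x y hp => by rw [D.dirDeriv_explicitMetric γ ε hp]; simp) hp]
  refine dirDeriv_eq_of_hasDerivAt ((D.smoothOn_formDeriv γ ε w).differentiableAt hp) ?_
  rw [D.dirDeriv_explicitMetric γ ε hp]
  set b' := (-2 * sprayCoeff g q x y) • x with hb'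
  have dα := D.hasDerivAt_sqrt_alphaSq_spray hp
  rw [← hb'] at dα
  have dc := hasDerivAt_radial_line y hx (D.hasDerivAt_c hJ)
  have dT := hasDerivAt_radial_line y hx (D.hasDerivAt_T _ hJ)
  have dK := hasDerivAt_radial_line y hx (D.hasDerivAt_Tb _ hJ)
  have dh := hasDerivAt_radial_line y hx (D.hasDerivAt_h hJ)
  have dr := hasDerivAt_norm_line y hx
  have db := hasDerivAt_inner_line (x := x) (y := y) y b'
  have de := hasDerivAt_normSq_line (x := y) b'
  have dxw := hasDerivAt_inner_const_line (x := x) y w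
  have dyw := hasDerivAt_inner_const_line (x := y) b' w
  have dI := dh.add (db.mul (((dK.div (dc.mul dα) (by simpa using ⟨hc, hα⟩)).const_mul ε).add
    ((((((dr.pow 2).mul dK).add (dT.const_mul 2)).div ((dc.pow 2).mul dα)
      (by simpa using ⟨hc, hα⟩)).sub (((dT.mul dK).mul (db.pow 2)).div
        ((dc.pow 2).mul (dα.pow 3)) (by simpa using ⟨hc, hα⟩))).const_mul γ)))
  have dN := ((hasDerivAt_const (0 : ℝ) ε).div dα (by simpa using hα)).add
    ((((de.mul (dr.pow 2)).sub (db.pow 2)).const_mul γ).div (dα.pow 3) (by simpa using hα))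
  -- The `formDerivNormSq` factor N = ε/α + γδ/α³ is constant along S, since α and δ are, so the
  -- ⟨y,w⟩ terms on the two sides agree. The content of the identity is the coefficient of ⟨x,w⟩:
  -- S(I) − 2QN = R, with I and R the inner-product and radial derivatives.
  refine ((dI.mul dxw).add (dN.mul dyw)).congr_deriv ?_
  simp only [zero_smul, add_zero, Pi.mul_apply, Pi.pow_apply, Pi.add_apply, Pi.sub_apply,
    Pi.div_apply, formDerivRadial, formDerivInner, formDerivNormSq]
  clear dI dN dα dc dT dK dh dr db de dxw dyw
  simp only [hb', inner_smul_right, real_inner_self_eq_norm_sq,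
    real_inner_comm x y, sprayCoeff, inner_zero_right, real_inner_comm w]
  generalize hcc : T ‖x‖ - ‖x‖ ^ 2 * Tb ‖x‖ = c at *
  have hT : T ‖x‖ = c + ‖x‖ ^ 2 * Tb ‖x‖ := by rw [← hcc]; ring
  have he : ‖y‖ ^ 2 = (√(alphaSq T Tb x y) ^ 2 - Tb ‖x‖ * inner ℝ x y ^ 2) / c := by
    rw [hsq]; field_simp; ring
  simp only [he, hT]
  generalize √(alphaSq T Tb x y) = α at *
  generalize Tb ‖x‖ = K at *
  generalize ‖x‖ = r at *
  push_cast
  field_simp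
  ring

end explicit

theorem IsFinslerMetric.homogeneous_pow {M : Set (E n)} {F : E n → E n → ℝ}
    (hF : IsFinslerMetric M F) :
    ∀ x ∈ M, ∀ y, ∀ c : ℝ, 0 < c → F x (c • y) = c ^ 1 * F x y := by
  simpa using hF.homogeneous

/-! ### Geodesic coefficients, Riemann endomorphism and Douglas curvature of the explicit metric. -/

section explicit

variable {J : Set ℝ} {g q h T Tb : ℝ → ℝ} (D : RadialData J g q h T Tb)

include D

/-- The derivative of g is expressed through g and q, so q' is the only derivative of a radial
function left in the formula. -/
theorem RadialData.dirDeriv_sprayCoeff {x y : E n}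
    (hp : (x, y) ∈ slitTangent (radialDomain n J)) (v w : E n) :
    dirDeriv (v, w) (sprayCoeff g q) x y =
      ((q ‖x‖ * (1 - 2 * ‖x‖ ^ 2 * g ‖x‖) - 2 * g ‖x‖ ^ 2) * ‖y‖ ^ 2
          + deriv q ‖x‖ / ‖x‖ * inner ℝ x y ^ 2) * inner ℝ x v
        + 2 * g ‖x‖ * inner ℝ y w
        + 2 * q ‖x‖ * inner ℝ x y * (inner ℝ v y + inner ℝ x w) := by
  have hJ : ‖x‖ ∈ J := hp.1
  have hx := D.ne_zero hJ
  have hr := norm_ne_zero_iff.2 hx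
  refine dirDeriv_eq_of_hasDerivAt (D.smoothOn_sprayCoeff.differentiableAt hp) ?_
  have dg := hasDerivAt_radial_line v hx (D.hasDerivAt_g _ hJ)
  have dq := hasDerivAt_radial_line v hx
    ((D.smooth_q _ hJ).differentiableAt (by simp)).hasDerivAt
  have db := hasDerivAt_inner_line (x := x) (y := y) v w
  have de := hasDerivAt_normSq_line (x := y) w
  refine ((dg.mul de).add (dq.mul (db.pow 2))).congr_deriv ?_
  simp only [zero_smul, add_zero, Pi.pow_apply]
  push_cast
  field_simp
  ring

theorem RadialData.dirDeriv_snd_sprayCoeff {x y : E n}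
    (hp : (x, y) ∈ slitTangent (radialDomain n J)) (w : E n) :
    dirDeriv (0, w) (sprayCoeff g q) x y =
      2 * g ‖x‖ * inner ℝ y w + 2 * q ‖x‖ * inner ℝ x y * inner ℝ x w := by
  rw [D.dirDeriv_sprayCoeff hp]
  simp

theorem RadialData.dirDeriv_radial_sprayCoeff {x y : E n}
    (hp : (x, y) ∈ slitTangent (radialDomain n J)) :
    dirDeriv (0, y) (sprayCoeff g q) x y = 2 * sprayCoeff g q x y := by
  rw [D.dirDeriv_snd_sprayCoeff hp, sprayCoeff, real_inner_self_eq_norm_sq]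
  ring

theorem RadialData.dirDeriv_dirDeriv_sprayCoeff {x y : E n}
    (hp : (x, y) ∈ slitTangent (radialDomain n J)) (v u w : E n) :
    dirDeriv (v, u) (dirDeriv (0, w) (sprayCoeff g q)) x y =
      2 * (q ‖x‖ * (1 - 2 * ‖x‖ ^ 2 * g ‖x‖) - 2 * g ‖x‖ ^ 2) * inner ℝ x v * inner ℝ y w
        + 2 * g ‖x‖ * inner ℝ u w
        + 2 * (deriv q ‖x‖ / ‖x‖) * inner ℝ x v * inner ℝ x y * inner ℝ x w
        + 2 * q ‖x‖ * (inner ℝ v y + inner ℝ x u) * inner ℝ x w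
        + 2 * q ‖x‖ * inner ℝ x y * inner ℝ v w := by
  have hJ : ‖x‖ ∈ J := hp.1
  have hx := D.ne_zero hJ
  have hr := norm_ne_zero_iff.2 hx
  have hcongr : ∀ x y : E n, (x, y) ∈ slitTangent (radialDomain n J) →
      dirDeriv (0, w) (sprayCoeff g q) x y =
      2 * g ‖x‖ * inner ℝ y w + 2 * q ‖x‖ * inner ℝ x y * inner ℝ x w :=
    fun x y hp => D.dirDeriv_snd_sprayCoeff hp w
  have hs : SmoothOn (slitTangent (radialDomain n J)) fun x y =>
      2 * g ‖x‖ * inner ℝ y w + 2 * q ‖x‖ * inner ℝ x y * inner ℝ x w :=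
    (D.smoothOn_sprayCoeff.dirDeriv (0, w)).congr D.isOpen_slitTangent
      fun x y hp => (hcongr x y hp).symm
  rw [dirDeriv_congr D.isOpen_slitTangent hcongr hp]
  refine dirDeriv_eq_of_hasDerivAt (hs.differentiableAt hp) ?_
  have dg := hasDerivAt_radial_line v hx (D.hasDerivAt_g _ hJ)
  have dq := hasDerivAt_radial_line v hx
    ((D.smooth_q _ hJ).differentiableAt (by simp)).hasDerivAt
  have db := hasDerivAt_inner_line (x := x) (y := y) v u
  have dxw := hasDerivAt_inner_const_line (x := x) v w
  have dyw := hasDerivAt_inner_const_line (x := y) u w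
  refine (((dg.const_mul 2).mul dyw).add (((dq.const_mul 2).mul db).mul dxw)).congr_deriv ?_
  simp only [zero_smul, add_zero, Pi.mul_apply]
  field_simp
  ring

/-- The obstruction to the Riemann endomorphism being a multiple of the identity modulo `y`
vanishes. -/
theorem RadialData.sprayCoeff_identity {x y : E n}
    (hp : (x, y) ∈ slitTangent (radialDomain n J)) (P : ℝ) (w : E n) :
    2 * dirDeriv (w, 0) (sprayCoeff g q) x y
      - dirDeriv (y, (-2 : ℝ) • (P • y + sprayCoeff g q x y • x))
          (dirDeriv (0, w) (sprayCoeff g q)) x y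
      - 2 * P * dirDeriv (0, w) (sprayCoeff g q) x y
      - dirDeriv (0, w) (sprayCoeff g q) x y * dirDeriv (0, x) (sprayCoeff g q) x y = 0 := by
  -- The terms in P cancel because Q_w is homogeneous of degree one in y, and those in q' cancel
  -- between the first two summands. The coefficient of ⟨y,w⟩ vanishes because g'/r = q(1 − 2r²g) −
  -- 2g², which explains the choice of q.
  rw [D.dirDeriv_dirDeriv_sprayCoeff hp, D.dirDeriv_sprayCoeff hp, D.dirDeriv_snd_sprayCoeff hp,
    D.dirDeriv_snd_sprayCoeff hp]
  simp only [smul_add, inner_add_left, inner_add_right, real_inner_smul_left, inner_smul_right,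
    real_inner_self_eq_norm_sq, real_inner_comm x y, sprayCoeff, inner_zero_right,
    real_inner_comm y w]
  ring

section metric

variable {γ ε : ℝ}
  (hF : IsFinslerMetric (radialDomain n J) (explicitMetric n h T Tb γ ε))

/-- The coefficient of `y` in the spray. -/
noncomputable def projCoeff (g q : ℝ → ℝ) (F : E n → E n → ℝ) (x y : E n) : ℝ :=
  dirDeriv (y, (-2 * sprayCoeff g q x y) • x) F x y / (2 * F x y)

theorem RadialData.smoothOn_sprayField :
    SmoothOn (slitTangent (radialDomain n J)) fun x y => (y, (-2 * sprayCoeff g q x y) • x) :=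
  (SmoothOn.snd _).prodMk (((SmoothOn.const _ _).mul D.smoothOn_sprayCoeff).smul (SmoothOn.fst _))

include hF

theorem RadialData.metric_ne_zero {x y : E n} (hp : (x, y) ∈ slitTangent (radialDomain n J)) :
    explicitMetric n h T Tb γ ε x y ≠ 0 := by
  have := hF.sq_pos (isOpen_radialDomain D.isOpen) hp
  intro h0
  simp [h0] at this

theorem RadialData.smoothOn_projCoeff :
    SmoothOn (slitTangent (radialDomain n J))
      (projCoeff g q (explicitMetric n h T Tb γ ε)) :=
  (hF.smoothOn.dirDeriv_field D.smoothOn_sprayField).div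
    ((SmoothOn.const _ _).mul hF.smoothOn)
    fun _ _ hp => mul_ne_zero two_ne_zero (D.metric_ne_zero hF hp)

theorem RadialData.projCoeff_mul {x y : E n} (hp : (x, y) ∈ slitTangent (radialDomain n J)) :
    dirDeriv (y, (-2 * sprayCoeff g q x y) • x) (explicitMetric n h T Tb γ ε) x y =
      projCoeff g q (explicitMetric n h T Tb γ ε) x y *
        (2 * explicitMetric n h T Tb γ ε x y) := by
  rw [projCoeff, div_mul_cancel₀]
  exact mul_ne_zero two_ne_zero (D.metric_ne_zero hF hp)

/-- The field with vertical part −2(Py + Qx) is S − 2P·(0,y). It annihilates F by the choice of P,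
and it acts on F_w as S does because F_w is homogeneous of degree zero. The Rapcsák equation
therefore becomes the Euler–Lagrange equation of F². -/
theorem RadialData.geodesicVec_eq {x y : E n} (hp : (x, y) ∈ slitTangent (radialDomain n J)) :
    geodesicVec (explicitMetric n h T Tb γ ε) x y =
      projCoeff g q (explicitMetric n h T Tb γ ε) x y • y + sprayCoeff g q x y • x := by
  have hM := isOpen_radialDomain (n := n) D.isOpen
  have hU := D.isOpen_slitTangent (n := n)
  have hs := hF.smoothOn
  symm
  rw [eulerLagrange_iff hU hF.smoothOn_sq hp (hF.det_ne_zero x y hp)]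
  intro w
  have hsq : ∀ (v : E n × E n) (x y : E n), (x, y) ∈ slitTangent (radialDomain n J) →
      dirDeriv v (fun x y => explicitMetric n h T Tb γ ε x y ^ 2) x y =
        2 * explicitMetric n h T Tb γ ε x y * dirDeriv v (explicitMetric n h T Tb γ ε) x y := by
    intro v x y hp
    simp only [pow_two]
    rw [dirDeriv_mul hs hs hp]
    ring
  have hP := D.projCoeff_mul hF hp
  have hR := D.dirDeriv_spray_dirDeriv γ ε hp w
  have hE := dirDeriv_radial hs hF.homogeneous_pow hp
  have hE2 := dirDeriv_radial_dirDeriv hM hs hF.homogeneous_pow hp (0, w)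
  set P := projCoeff g q (explicitMetric n h T Tb γ ε) x y
  have hdir : ∀ f : E n → E n → ℝ, dirDeriv (y, (-2 : ℝ) • (P • y + sprayCoeff g q x y • x)) f x y =
      dirDeriv (y, (-2 * sprayCoeff g q x y) • x) f x y - 2 * P * dirDeriv (0, y) f x y := by
    intro f
    rw [dirDeriv_split, dirDeriv_split y ((-2 * sprayCoeff g q x y) • x)]
    simp only [dirDeriv_snd_smul, dirDeriv_snd_add, smul_eq_mul]
    ring
  rw [dirDeriv_congr hU (hsq (0, w)) hp, hsq _ _ _ hp,
    dirDeriv_mul ((SmoothOn.const _ _).mul hs) (hs.dirDeriv _) hp,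
    dirDeriv_mul (SmoothOn.const _ _) hs hp, dirDeriv_const, hdir, hdir, hR, hP, hE, hE2]
  push_cast
  ring

/-- Differentiating S(F) = 2PF radially, with Q of degree two and F of degree one, shows that P has
degree one. This is needed for the trace of the y-derivative of G. -/
theorem RadialData.dirDeriv_radial_projCoeff {x y : E n}
    (hp : (x, y) ∈ slitTangent (radialDomain n J)) :
    dirDeriv (0, y) (projCoeff g q (explicitMetric n h T Tb γ ε)) x y =
      projCoeff g q (explicitMetric n h T Tb γ ε) x y := by
  have hM := isOpen_radialDomain (n := n) D.isOpen
  have hU := D.isOpen_slitTangent (n := n)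
  have hs := hF.smoothOn
  have hQ := D.smoothOn_sprayCoeff (n := n)
  have hP := D.smoothOn_projCoeff hF
  have h1 := dirDeriv_field hs D.smoothOn_sprayField hp (0, y)
  rw [dirDeriv_congr hU (fun _ _ hp => D.projCoeff_mul hF hp) hp,
    dirDeriv_mul hP ((SmoothOn.const _ _).mul hs) hp, dirDeriv_mul (SmoothOn.const _ _) hs hp,
    dirDeriv_const, dirDeriv_radial hs hF.homogeneous_pow hp,
    dirDeriv_radial_dirDeriv hM hs hF.homogeneous_pow hp,
    dirDeriv_prodMk (SmoothOn.snd _) (((SmoothOn.const _ _).mul hQ).smul (SmoothOn.fst _)) hp,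
    dirDeriv_snd, dirDeriv_smul ((SmoothOn.const _ _).mul hQ) (SmoothOn.fst _) hp,
    dirDeriv_mul (SmoothOn.const _ _) hQ hp, dirDeriv_const, dirDeriv_fst,
    D.dirDeriv_radial_sprayCoeff hp] at h1
  have h2 := D.projCoeff_mul hF hp
  rw [dirDeriv_split y ((-2 * sprayCoeff g q x y) • x)] at h1 h2
  simp only [smul_zero, zero_add, zero_mul, add_zero, dirDeriv_snd_smul, smul_eq_mul] at h1 h2
  rw [dirDeriv_split y, dirDeriv_snd_smul, smul_eq_mul] at h1
  push_cast at h1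
  have h3 := D.metric_ne_zero hF hp
  apply mul_right_cancel₀ (mul_ne_zero two_ne_zero h3)
  linear_combination h1 + 2 * h2

theorem RadialData.dirDeriv_geodesicVec {x y : E n}
    (hp : (x, y) ∈ slitTangent (radialDomain n J)) (v : E n × E n) :
    dirDeriv v (geodesicVec (explicitMetric n h T Tb γ ε)) x y =
      projCoeff g q (explicitMetric n h T Tb γ ε) x y • v.2
        + dirDeriv v (projCoeff g q (explicitMetric n h T Tb γ ε)) x y • y
        + (sprayCoeff g q x y • v.1 + dirDeriv v (sprayCoeff g q) x y • x) := by
  have hP := D.smoothOn_projCoeff hF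
  have hQ := D.smoothOn_sprayCoeff (n := n)
  rw [dirDeriv_congr D.isOpen_slitTangent (fun _ _ hp => D.geodesicVec_eq hF hp) hp,
    dirDeriv_add (hP.smul (SmoothOn.snd _)) (hQ.smul (SmoothOn.fst _)) hp,
    dirDeriv_smul hP (SmoothOn.snd _) hp, dirDeriv_smul hQ (SmoothOn.fst _) hp,
    dirDeriv_fst, dirDeriv_snd]

/-- The Riemann endomorphism is a multiple of the identity modulo `y`. -/
theorem RadialData.riemannMap_eq {x y : E n} (hp : (x, y) ∈ slitTangent (radialDomain n J)) :
    ∃ μ : ℝ, ∀ u, ∃ τ : ℝ,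
      riemannMap (explicitMetric n h T Tb γ ε) x y u = μ • u + τ • y := by
  have hM := isOpen_radialDomain (n := n) D.isOpen
  have hU := D.isOpen_slitTangent (n := n)
  have hP := D.smoothOn_projCoeff hF
  have hQ := D.smoothOn_sprayCoeff (n := n)
  have hG := D.geodesicVec_eq hF hp
  set P := projCoeff g q (explicitMetric n h T Tb γ ε) with hPdef
  set Q := sprayCoeff (n := n) g q with hQdef
  set S : E n × E n := (y, (-2 : ℝ) • (P x y • y + Q x y • x)) with hS
  -- Here S is the full spray of F. Inserting G = Py + Qx in the formula for R_y(u), this is the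
  -- coefficient of u, and it does not involve u.
  refine ⟨2 * Q x y - dirDeriv S P x y - P x y ^ 2, fun u => ?_⟩
  have hsecond : dirDeriv S (dirDeriv (0, u) (geodesicVec (explicitMetric n h T Tb γ ε))) x y =
      dirDeriv S P x y • u + dirDeriv S (dirDeriv (0, u) P) x y • y
        + dirDeriv (0, u) P x y • S.2 + dirDeriv S (dirDeriv (0, u) Q) x y • x
        + dirDeriv (0, u) Q x y • y := by
    rw [dirDeriv_congr (g := fun x y => P x y • u + dirDeriv (0, u) P x y • y
        + dirDeriv (0, u) Q x y • x) hU
      (fun x y hp => by rw [D.dirDeriv_geodesicVec hF hp]; simp [hPdef, hQdef]) hp,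
      dirDeriv_add ((hP.smul (SmoothOn.const _ _)).add ((hP.dirDeriv _).smul (SmoothOn.snd _)))
        ((hQ.dirDeriv _).smul (SmoothOn.fst _)) hp,
      dirDeriv_add (hP.smul (SmoothOn.const _ _)) ((hP.dirDeriv _).smul (SmoothOn.snd _)) hp,
      dirDeriv_smul hP (SmoothOn.const _ _) hp, dirDeriv_smul (hP.dirDeriv _) (SmoothOn.snd _) hp,
      dirDeriv_smul (hQ.dirDeriv _) (SmoothOn.fst _) hp, dirDeriv_fst, dirDeriv_snd,
      dirDeriv_const]
    simp only [hS]
    module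
  have hid := D.sprayCoeff_identity hp (P x y) u
  rw [← hQdef, ← hS] at hid
  have hQy : dirDeriv (0, y) Q x y = 2 * Q x y := D.dirDeriv_radial_sprayCoeff hp
  set Pu := dirDeriv (0, u) P x y with hPu
  set Qu := dirDeriv (0, u) Q x y with hQu
  have hNu : dirDeriv (0, u) (geodesicVec (explicitMetric n h T Tb γ ε)) x y =
      P x y • u + Pu • y + Qu • x := by
    rw [D.dirDeriv_geodesicVec hF hp]
    simp [← hPdef, ← hQdef, hPu, hQu]
  have hNNQ : dirDeriv (0, P x y • u + Pu • y + Qu • x) Q x y =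
      P x y * Qu + Pu * (2 * Q x y) + Qu * dirDeriv (0, x) Q x y := by
    simp only [dirDeriv_snd_add, dirDeriv_snd_smul, hQy, smul_eq_mul, hQu]
  rw [hF.riemannMap_eq hM hp, hG, ← hS, hsecond, D.dirDeriv_geodesicVec hF hp, hNu,
    D.dirDeriv_geodesicVec hF hp, ← hPdef, ← hQdef]
  simp only [hNNQ]
  -- `hid` says that the coefficient of x in R_y(u) is zero; as a vector equation it is exactly the
  -- difference between R_y(u) and μu + τy.
  have hx0 : ∀ c : ℝ, c = 0 → c • x = 0 := by
    rintro c rfl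
    simp
  have key := hx0 _ hid
  refine ⟨2 * dirDeriv (u, 0) P x y - dirDeriv S (dirDeriv (0, u) P) x y + 2 * Pu * P x y - Qu
    - P x y * Pu - dirDeriv (0, P x y • u + Pu • y + Qu • x) P x y, ?_⟩
  refine sub_eq_zero.1 (Eq.trans ?_ key)
  simp only [hS]
  module

theorem RadialData.flagCurvature_eq {x y u v : E n} (hx : ‖x‖ ∈ J)
    (hu : LinearIndependent ℝ ![y, u]) (hv : LinearIndependent ℝ ![y, v]) :
    flagCurvature (explicitMetric n h T Tb γ ε) x y u =
      flagCurvature (explicitMetric n h T Tb γ ε) x y v := by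
  have hy : y ≠ 0 := by simpa using hu.ne_zero 0
  have hM := isOpen_radialDomain (n := n) D.isOpen
  obtain ⟨μ, hμ⟩ := D.riemannMap_eq hF (x := x) (y := y) ⟨hx, hy⟩
  rw [hF.flagCurvature_eq hM ⟨hx, hy⟩ hμ hu, hF.flagCurvature_eq hM ⟨hx, hy⟩ hμ hv]

/-- The projectively invariant part of the spray is quadratic in `y`. -/
theorem RadialData.projective_spray_eq {x y : E n}
    (hp : (x, y) ∈ slitTangent (radialDomain n J)) (i : Fin n) :
    geodesicCoeff (explicitMetric n h T Tb γ ε) i x y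
      - 1 / ((n : ℝ) + 1) * (∑ m, partialY m (geodesicCoeff (explicitMetric n h T Tb γ ε) m) x y)
        * y i =
      sprayCoeff g q x y * x i
        - 2 * (g ‖x‖ + q ‖x‖ * ‖x‖ ^ 2) / ((n : ℝ) + 1) * inner ℝ x y * y i := by
  have hM := isOpen_radialDomain (n := n) D.isOpen
  have hG : geodesicCoeff (explicitMetric n h T Tb γ ε) i x y =
      projCoeff g q (explicitMetric n h T Tb γ ε) x y * y i + sprayCoeff g q x y * x i := by
    change geodesicVec (explicitMetric n h T Tb γ ε) x y i = _
    rw [D.geodesicVec_eq hF hp]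
    simp
  -- The term Py contributes nP plus P once more by homogeneity, so division by n + 1 makes P
  -- disappear from the projective spray.
  have hsum : ∑ m, partialY m (geodesicCoeff (explicitMetric n h T Tb γ ε) m) x y =
      ((n : ℝ) + 1) * projCoeff g q (explicitMetric n h T Tb γ ε) x y
        + 2 * (g ‖x‖ + q ‖x‖ * ‖x‖ ^ 2) * inner ℝ x y := by
    have hterm : ∀ m, partialY m (geodesicCoeff (explicitMetric n h T Tb γ ε) m) x y =
        projCoeff g q (explicitMetric n h T Tb γ ε) x y
        + y m • dirDeriv (0, EuclideanSpace.single m 1)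
            (projCoeff g q (explicitMetric n h T Tb γ ε)) x y
        + x m • dirDeriv (0, EuclideanSpace.single m 1) (sprayCoeff g q) x y := by
      intro m
      rw [partialY_eq (hF.smoothOn_geodesicCoeff hM m) hp]
      change dirDeriv _ (fun x y => geodesicVec (explicitMetric n h T Tb γ ε) x y m) x y = _
      rw [dirDeriv_apply (hF.smoothOn_geodesicVec hM) hp, D.dirDeriv_geodesicVec hF hp]
      simp
      ring
    simp only [hterm, Finset.sum_add_distrib, ← dirDeriv_eq_sum_snd]
    rw [D.dirDeriv_radial_projCoeff hF hp, D.dirDeriv_snd_sprayCoeff hp,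
      real_inner_self_eq_norm_sq, real_inner_comm x y]
    simp
    ring
  rw [hG, hsum]
  have hn : ((n : ℝ) + 1) ≠ 0 := by positivity
  field_simp
  ring

/-- The Douglas curvature vanishes away from the origin. -/
theorem RadialData.douglasCurvature_eq_zero {x y : E n}
    (hp : (x, y) ∈ slitTangent (radialDomain n J)) (j i k l : Fin n) :
    douglasCurvature (explicitMetric n h T Tb γ ε) j i k l x y = 0 := by
  have hU := D.isOpen_slitTangent (n := n)
  have hg := smoothOn_radial (n := n) D.pos D.smooth_g
  have hq := smoothOn_radial (n := n) D.pos D.smooth_q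
  have hr := smoothOn_radial (n := n) D.pos (ρ := id) fun _ _ => contDiffAt_id
  have hb := smoothOn_inner (slitTangent (radialDomain n J))
  have hκ : SmoothOn (slitTangent (radialDomain n J)) fun (x : E n) (_ : E n) =>
      2 * (g ‖x‖ + q ‖x‖ * ‖x‖ ^ 2) / ((n : ℝ) + 1) :=
    ((SmoothOn.const _ _).mul (hg.add (hq.mul (hr.pow 2)))).div (SmoothOn.const _ _)
      fun _ _ _ => by positivity
  have hxi := (SmoothOn.fst (slitTangent (radialDomain n J))).apply i
  have hyi := (SmoothOn.snd (slitTangent (radialDomain n J))).apply i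
  have dyi : ∀ (y : E n) (w : E n), HasDerivAt (fun t : ℝ => (y + t • w) i) (w i) 0 := by
    intro y w
    simpa using ((hasDerivAt_id (0 : ℝ)).mul_const (w i)).const_add (y i)
  have h1 : ∀ x y : E n, (x, y) ∈ slitTangent (radialDomain n J) →
      partialY l (fun x y => geodesicCoeff (explicitMetric n h T Tb γ ε) i x y
      - 1 / ((n : ℝ) + 1) * (∑ m, partialY m (geodesicCoeff (explicitMetric n h T Tb γ ε) m) x y)
        * y i) x y =
      (2 * g ‖x‖ * inner ℝ y (EuclideanSpace.single l (1 : ℝ))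
          + 2 * q ‖x‖ * inner ℝ x y * inner ℝ x (EuclideanSpace.single l (1 : ℝ))) * x i
        - 2 * (g ‖x‖ + q ‖x‖ * ‖x‖ ^ 2) / ((n : ℝ) + 1) *
          (inner ℝ x (EuclideanSpace.single l (1 : ℝ)) * y i
            + inner ℝ x y * EuclideanSpace.single l (1 : ℝ) i) := by
    intro x y hp
    rw [partialY_congr hU (fun x y hp => D.projective_spray_eq hF hp i) hp,
      partialY_eq ((D.smoothOn_sprayCoeff.mul hxi).sub ((hκ.mul hb).mul hyi)) hp]
    refine dirDeriv_eq_of_hasDerivAt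
      (((D.smoothOn_sprayCoeff.mul hxi).sub ((hκ.mul hb).mul hyi)).differentiableAt hp) ?_
    have db := hasDerivAt_inner_line (x := x) (y := y) 0 (EuclideanSpace.single l (1 : ℝ))
    have de := hasDerivAt_normSq_line (x := y) (EuclideanSpace.single l (1 : ℝ))
    simp only [smul_zero, add_zero] at db ⊢
    refine (((de.const_mul (g ‖x‖)).add ((db.pow 2).const_mul (q ‖x‖))).mul_const (x i)).sub
      ((db.const_mul _).mul (dyi y _)) |>.congr_deriv ?_
    simp only [zero_smul, add_zero, inner_zero_left, zero_add]
    push_cast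
    ring
  have h2 : ∀ x y : E n, (x, y) ∈ slitTangent (radialDomain n J) →
      partialY k (partialY l (fun x y => geodesicCoeff (explicitMetric n h T Tb γ ε) i x y
      - 1 / ((n : ℝ) + 1) * (∑ m, partialY m (geodesicCoeff (explicitMetric n h T Tb γ ε) m) x y)
        * y i)) x y =
      (2 * g ‖x‖ * inner ℝ (EuclideanSpace.single k (1 : ℝ)) (EuclideanSpace.single l (1 : ℝ))
          + 2 * q ‖x‖ * inner ℝ x (EuclideanSpace.single k (1 : ℝ))
            * inner ℝ x (EuclideanSpace.single l (1 : ℝ))) * x i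
        - 2 * (g ‖x‖ + q ‖x‖ * ‖x‖ ^ 2) / ((n : ℝ) + 1) *
          (inner ℝ x (EuclideanSpace.single l (1 : ℝ)) * EuclideanSpace.single k (1 : ℝ) i
            + inner ℝ x (EuclideanSpace.single k (1 : ℝ)) * EuclideanSpace.single l (1 : ℝ) i) := by
    intro x y hp
    have hs : SmoothOn (slitTangent (radialDomain n J)) fun (x y : E n) =>
      (2 * g ‖x‖ * inner ℝ y (EuclideanSpace.single l (1 : ℝ))
          + 2 * q ‖x‖ * inner ℝ x y * inner ℝ x (EuclideanSpace.single l (1 : ℝ))) * x i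
        - 2 * (g ‖x‖ + q ‖x‖ * ‖x‖ ^ 2) / ((n : ℝ) + 1) *
          (inner ℝ x (EuclideanSpace.single l (1 : ℝ)) * y i
            + inner ℝ x y * EuclideanSpace.single l (1 : ℝ) i) :=
      (((((SmoothOn.const _ _).mul hg).mul (smoothOn_inner_snd _ _)).add
        ((((SmoothOn.const _ _).mul hq).mul hb).mul (smoothOn_inner_fst _ _))).mul hxi).sub
        (hκ.mul (((smoothOn_inner_fst _ _).mul hyi).add (hb.mul (SmoothOn.const _ _))))
    rw [partialY_congr hU h1 hp, partialY_eq hs hp]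
    refine dirDeriv_eq_of_hasDerivAt (hs.differentiableAt hp) ?_
    have db := hasDerivAt_inner_line (x := x) (y := y) 0 (EuclideanSpace.single k (1 : ℝ))
    have dyl := hasDerivAt_inner_const_line (x := y) (EuclideanSpace.single k (1 : ℝ))
      (EuclideanSpace.single l (1 : ℝ))
    simp only [smul_zero, add_zero, inner_zero_left, zero_add] at db ⊢
    refine (((dyl.const_mul (2 * g ‖x‖)).add ((db.const_mul (2 * q ‖x‖)).mul_const _)).mul_const
      (x i)).sub ((((dyi y _).const_mul _).add (db.mul_const _)).const_mul _) |>.congr_deriv ?_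
    ring
  -- After two vertical derivatives nothing depends on y.
  rw [douglasCurvature, partialY_congr hU h2 hp]
  simp [partialY]

end metric

end explicit

/-! ### The radial functions of the theorem -/

/-- The chosen antiderivatives come only with a first derivative; their smoothness is inherited from
that of the integrands. -/
theorem contDiffAt_of_hasDerivAt {J : Set ℝ} (hJ : IsOpen J) {f f' : ℝ → ℝ}
    (hf : ∀ r ∈ J, HasDerivAt f (f' r) r) (hf' : ∀ r ∈ J, ContDiffAt ℝ ∞ f' r) :
    ∀ r ∈ J, ContDiffAt ℝ ∞ f r := by
  intro r hr
  refine ContDiffOn.contDiffAt ?_ (hJ.mem_nhds hr)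
  refine (contDiffOn_infty_iff_deriv_of_isOpen hJ).2
    ⟨fun r hr => (hf r hr).differentiableAt.differentiableWithinAt, ?_⟩
  exact ContDiffOn.congr (fun r hr => (hf' r hr).contDiffWithinAt) fun r hr => (hf r hr).deriv

/-- With ω = 1 − 2r²g, the logarithmic derivative of T is −4rg/ω − 2ω'/ω = 4r(g + rg')/ω, which
equals 4r(g + qr²). The equation for g is the definition of q solved for g'. -/
theorem radialData_of_isIntegralChoice {J : Set ℝ} (hJ : IsOpen J) (hJ0 : ∀ r ∈ J, 0 < r)
    {g h A Tb : ℝ → ℝ} (hg : ∀ r ∈ J, ContDiffAt ℝ ∞ g r) (hh : ∀ r ∈ J, ContDiffAt ℝ ∞ h r)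
    (hne : ∀ r ∈ J, 1 - 2 * r ^ 2 * g r ≠ 0) (hint : IsIntegralChoice J g A Tb)
    (hpos : ∀ r ∈ J, ∀ s : ℝ, |s| ≤ r → 0 < Tfun g A r - Tb r * (r ^ 2 - s ^ 2)) :
    RadialData J g (fun r => (deriv g r + 2 * r * g r ^ 2) / (r * (1 - 2 * r ^ 2 * g r)))
      h (Tfun g A) Tb := by
  have hid : ∀ r : ℝ, ContDiffAt ℝ ∞ (fun r : ℝ => r) r := fun _ => contDiffAt_id
  have hdg : ∀ r ∈ J, ContDiffAt ℝ ∞ (deriv g) r := by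
    intro r hr
    have h1 : ContDiffAt ℝ ∞ (fderiv ℝ g) r := (hg r hr).fderiv_right (by simp)
    exact h1.clm_apply (contDiffAt_const (c := (1 : ℝ)))
  have hden : ∀ r ∈ J, ContDiffAt ℝ ∞ (fun r => 1 - 2 * r ^ 2 * g r) r := fun r hr =>
    contDiffAt_const.sub ((contDiffAt_const.mul ((hid r).pow 2)).mul (hg r hr))
  have hq : ∀ r ∈ J, ContDiffAt ℝ ∞
      (fun r => (deriv g r + 2 * r * g r ^ 2) / (r * (1 - 2 * r ^ 2 * g r))) r := fun r hr =>
    ((hdg r hr).add ((contDiffAt_const.mul (hid r)).mul ((hg r hr).pow 2))).div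
      ((hid r).mul (hden r hr)) (mul_ne_zero (hJ0 r hr).ne' (hne r hr))
  have hA : ∀ r ∈ J, ContDiffAt ℝ ∞ A r :=
    contDiffAt_of_hasDerivAt hJ (fun r hr => hint.hasDerivAt_A r hr (hJ0 r hr)) fun r hr =>
      ((contDiffAt_const.mul (hid r)).mul (hg r hr)).div (hden r hr) (hne r hr)
  have hT : ∀ r ∈ J, ContDiffAt ℝ ∞ (Tfun g A) r := fun r hr =>
    (Real.contDiff_exp.contDiffAt.comp r (hA r hr).neg).div ((hden r hr).pow 2)
      (pow_ne_zero 2 (hne r hr))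
  have hdTb : ∀ r ∈ J, HasDerivAt Tb (4 * r * ((deriv g r + 2 * r * g r ^ 2) /
      (r * (1 - 2 * r ^ 2 * g r))) * Tfun g A r) r := by
    intro r hr
    refine (hint.hasDerivAt_Tb r hr (hJ0 r hr)).congr_deriv ?_
    have h1 := (hJ0 r hr).ne'
    have h2 := hne r hr
    field_simp
  have hgd : ∀ r ∈ J, HasDerivAt g (deriv g r) r := fun r hr =>
    ((hg r hr).differentiableAt (by simp)).hasDerivAt
  refine ⟨hJ, hJ0, hg, hq, hh, hT, ?_, ?_, ?_, hdTb, hpos⟩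
  · exact contDiffAt_of_hasDerivAt hJ hdTb fun r hr =>
      ((contDiffAt_const.mul (hid r)).mul (hq r hr)).mul (hT r hr)
  · intro r hr
    refine (hgd r hr).congr_deriv ?_
    have h1 := (hJ0 r hr).ne'
    have h2 := hne r hr
    generalize hw : 1 - 2 * r ^ 2 * g r = w at h2 ⊢
    field_simp
    ring
  · intro r hr
    have h1 := (hJ0 r hr).ne'
    have h2 := hne r hr
    have h3 := ((hasDerivAt_const r (1 : ℝ)).sub
      ((((hasDerivAt_id r).pow 2).const_mul 2).mul (hgd r hr))).pow 2
    have h4 := (hint.hasDerivAt_A r hr (hJ0 r hr)).neg.exp.div h3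
      (by simpa using h2)
    refine h4.congr_deriv ?_
    simp only [Tfun, Pi.pow_apply, Pi.sub_apply, Pi.mul_apply, Pi.neg_apply, id]
    clear h3 h4
    push_cast
    generalize hw : 1 - 2 * r ^ 2 * g r = w at h2 ⊢
    field_simp
    rw [← hw]
    ring

/-- Only the radial domain is assumed open; the positive radii are its preimage along a coordinate
ray. -/
theorem isOpen_pos_radii (hn : 0 < n) {I : Set ℝ} (hI : IsOpen (radialDomain n I)) :
    IsOpen (I ∩ Set.Ioi 0) := by
  have hc : Continuous fun r : ℝ => r • (EuclideanSpace.single (⟨0, hn⟩ : Fin n) (1 : ℝ)) := by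
    fun_prop
  convert (hI.preimage hc).inter (isOpen_Ioi (a := (0 : ℝ))) using 1
  ext r
  simp only [Set.mem_inter_iff, Set.mem_Ioi, Set.mem_preimage, radialDomain, Set.mem_ofPred_eq,
    norm_smul, PiLp.norm_single, norm_one, mul_one, Real.norm_eq_abs]
  refine and_congr_left fun hr => ?_
  rw [abs_of_pos hr]

/-! ### Extension over the origin -/

theorem eq_of_eventually_eq_punctured [Nontrivial (E n)] {f g : E n → ℝ}
    (hf : ContinuousAt f 0) (hg : ContinuousAt g 0)
    (h : ∀ᶠ x in nhds (0 : E n), x ≠ 0 → f x = g x) : f 0 = g 0 := by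
  refine tendsto_nhds_unique_of_eventuallyEq (l := nhdsWithin (0 : E n) {0}ᶜ)
    (hf.tendsto.mono_left nhdsWithin_le_nhds) (hg.tendsto.mono_left nhdsWithin_le_nhds) ?_
  filter_upwards [nhdsWithin_le_nhds h, self_mem_nhdsWithin] with x hx hx0 using hx hx0

theorem SmoothOn.continuousAt_fst {U : Set (E n × E n)} {f : E n → E n → ℝ} (hf : SmoothOn U f)
    {x y : E n} (hp : (x, y) ∈ U) : ContinuousAt (fun z => f z y) x := by
  have h1 : ContinuousAt (fun p : E n × E n => f p.1 p.2) ((fun z : E n => (z, y)) x) :=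
    (hf _ hp).continuousAt
  exact ContinuousAt.comp (f := fun z : E n => (z, y)) h1 (by fun_prop)

section finsler

variable {M : Set (E n)} {F : E n → E n → ℝ} (hM : IsOpen M) (hF : IsFinslerMetric M F)

theorem IsFinslerMetric.mono {M' : Set (E n)} (hF : IsFinslerMetric M F) (h : M' ⊆ M) :
    IsFinslerMetric M' F :=
  ⟨fun x hx => hF.nonneg x (h hx), fun x hx => hF.smooth x (h hx),
    fun x hx => hF.homogeneous x (h hx), fun x hx => hF.posDef x (h hx)⟩

include hM hF

theorem IsFinslerMetric.smoothOn_douglasCurvature (j i k l : Fin n) :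
    SmoothOn (slitTangent M) (douglasCurvature F j i k l) := by
  have hU := isOpen_slitTangent hM
  have hG := hF.smoothOn_geodesicCoeff hM
  refine SmoothOn.partialY hU (SmoothOn.partialY hU (SmoothOn.partialY hU ?_ l) k) j
  exact (hG i).sub (((SmoothOn.const _ _).mul (SmoothOn.sum fun m _ => (hG m).partialY hU m)).mul
    ((SmoothOn.snd _).apply i))

theorem IsFinslerMetric.smoothOn_riemannCurvature (i k : Fin n) :
    SmoothOn (slitTangent M) (riemannCurvature F i k) := by
  have hU := isOpen_slitTangent hM
  have hG := hF.smoothOn_geodesicCoeff hM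
  refine ((((SmoothOn.const _ _).mul ((hG i).partialX hU k)).sub
    (SmoothOn.sum fun j _ => ((SmoothOn.snd _).apply j).mul
      (((hG i).partialY hU k).partialX hU j))).add
    ((SmoothOn.const _ _).mul (SmoothOn.sum fun j _ => (hG j).mul
      (((hG i).partialY hU k).partialY hU j)))).sub
    (SmoothOn.sum fun j _ => ((hG i).partialY hU j).mul ((hG j).partialY hU k))

theorem IsFinslerMetric.continuousAt_flagCurvature {x y u : E n} (hx : x ∈ M)
    (hu : LinearIndependent ℝ ![y, u]) :
    ContinuousAt (fun z => flagCurvature F z y u) x := by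
  have hU := isOpen_slitTangent hM
  have hy : y ≠ 0 := by simpa using hu.ne_zero 0
  have hp : (x, y) ∈ slitTangent M := ⟨hx, hy⟩
  have hT := smoothOn_fundTensor hU hF.smoothOn_sq
  have hI : ∀ {f g : E n → E n → E n}, SmoothOn (slitTangent M) f → SmoothOn (slitTangent M) g →
      SmoothOn (slitTangent M) fun x y => fundInner F x y (f x y) (g x y) := by
    intro f g hf hg
    exact SmoothOn.sum fun i _ => SmoothOn.sum fun j _ =>
      ((hT i j).mul (hf.apply i)).mul (hg.apply j)
  have hR : SmoothOn (slitTangent M) fun x y => riemannMap F x y u :=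
    smoothOn_of_apply fun i => by
      change SmoothOn _ fun x y => ∑ k, riemannCurvature F i k x y * u k
      exact SmoothOn.sum fun k _ => (hF.smoothOn_riemannCurvature hM i k).mul (SmoothOn.const _ (u k))
  have hcu := SmoothOn.const (slitTangent M) u
  have hsy := SmoothOn.snd (slitTangent M)
  exact ((hI hR hcu).continuousAt_fst hp).div
    ((((hI hsy hsy).mul (hI hcu hcu)).sub ((hI hsy hcu).pow 2)).continuousAt_fst hp)
    -- The flag y, u is kept fixed while the base point moves, and the Gram determinant at the limit
    -- point is nonzero.
    (hF.gram_pos hM hp hu).ne'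

end finsler

section explicit

variable {J I : Set ℝ} {g q h T Tb : ℝ → ℝ} (D : RadialData J g q h T Tb)
  (hJ : J = I ∩ Set.Ioi 0) (hI : IsOpen (radialDomain n I)) {γ ε : ℝ}

theorem norm_mem_of_ne_zero {x : E n} (hx : x ∈ radialDomain n I) (h0 : x ≠ 0) :
    ‖x‖ ∈ I ∩ Set.Ioi 0 := ⟨hx, norm_pos_iff.2 h0⟩

theorem radialDomain_mono {I J : Set ℝ} (h : J ⊆ I) : radialDomain n J ⊆ radialDomain n I :=
  fun _ hx => h hx

include D hJ hI

theorem RadialData.isDouglas [Nontrivial (E n)]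
    (hF : IsFinslerMetric (radialDomain n I) (explicitMetric n h T Tb γ ε)) :
    IsDouglas (radialDomain n I) (explicitMetric n h T Tb γ ε) := by
  have hF' : IsFinslerMetric (radialDomain n J) (explicitMetric n h T Tb γ ε) :=
    hF.mono (radialDomain_mono (hJ ▸ Set.inter_subset_left))
  have hne : ∀ x ∈ radialDomain n I, x ≠ 0 → ∀ y, y ≠ 0 → ∀ j i k l : Fin n,
      douglasCurvature (explicitMetric n h T Tb γ ε) j i k l x y = 0 := by
    intro x hx hx0 y hy j i k l
    refine D.douglasCurvature_eq_zero hF' ⟨?_, hy⟩ j i k l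
    rw [hJ]
    exact norm_mem_of_ne_zero hx hx0
  intro x hx y hy j i k l
  rcases eq_or_ne x 0 with rfl | hx0
  · refine eq_of_eventually_eq_punctured (g := fun _ => 0)
      ((hF.smoothOn_douglasCurvature hI j i k l).continuousAt_fst ⟨hx, hy⟩) continuousAt_const ?_
    filter_upwards [hI.mem_nhds hx] with z hz hz0 using hne z hz hz0 y hy j i k l
  · exact hne x hx hx0 y hy j i k l

theorem RadialData.hasScalarFlagCurvature [Nontrivial (E n)]
    (hF : IsFinslerMetric (radialDomain n I) (explicitMetric n h T Tb γ ε)) :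
    HasScalarFlagCurvature (radialDomain n I) (explicitMetric n h T Tb γ ε) := by
  have hF' : IsFinslerMetric (radialDomain n J) (explicitMetric n h T Tb γ ε) :=
    hF.mono (radialDomain_mono (hJ ▸ Set.inter_subset_left))
  have hne : ∀ x ∈ radialDomain n I, x ≠ 0 → ∀ y u v : E n, LinearIndependent ℝ ![y, u] →
      LinearIndependent ℝ ![y, v] → flagCurvature (explicitMetric n h T Tb γ ε) x y u =
        flagCurvature (explicitMetric n h T Tb γ ε) x y v := by
    intro x hx hx0 y u v hu hv
    refine D.flagCurvature_eq hF' ?_ hu hv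
    rw [hJ]
    exact norm_mem_of_ne_zero hx hx0
  have hall : ∀ x ∈ radialDomain n I, ∀ y u v : E n, LinearIndependent ℝ ![y, u] →
      LinearIndependent ℝ ![y, v] → flagCurvature (explicitMetric n h T Tb γ ε) x y u =
        flagCurvature (explicitMetric n h T Tb γ ε) x y v := by
    intro x hx y u v hu hv
    rcases eq_or_ne x 0 with rfl | hx0
    · refine eq_of_eventually_eq_punctured (hF.continuousAt_flagCurvature hI hx hu)
        (hF.continuousAt_flagCurvature hI hx hv) ?_
      filter_upwards [hI.mem_nhds hx] with z hz hz0 using hne z hz hz0 y u v hu hv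
    · exact hne x hx hx0 y u v hu hv
  classical
  -- K is read off from an arbitrary flag with pole y. The default 0 is never tested, since without
  -- such a flag there is nothing to prove.
  refine ⟨fun x y => if hy : ∃ u, LinearIndependent ℝ ![y, u] then
    flagCurvature (explicitMetric n h T Tb γ ε) x y hy.choose else 0, fun x hx y u hu => ?_⟩
  have hy : ∃ u, LinearIndependent ℝ ![y, u] := ⟨u, hu⟩
  beta_reduce
  rw [dif_pos hy]
  exact hall x hx y u _ hu hy.choose_spec

end explicit

/-! ### Positivity of the fundamental tensor -/

theorem sphMetric_homogeneous (φ : ℝ → ℝ → ℝ) (x y : E n) {c : ℝ} (hc : 0 < c) :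
    sphMetric n φ x (c • y) = c * sphMetric n φ x y := by
  simp only [sphMetric, norm_smul, Real.norm_eq_abs, abs_of_pos hc, inner_smul_right,
    mul_div_mul_left _ _ hc.ne', mul_assoc]

theorem posDef_of_fundInner_pos {F : E n → E n → ℝ} {x y : E n}
    (hsymm : ∀ i j, fundTensor F x y i j = fundTensor F x y j i)
    (hpos : ∀ u, u ≠ 0 → 0 < fundInner F x y u u) : (fundTensor F x y).PosDef := by
  refine Matrix.PosDef.of_dotProduct_mulVec_pos ?_ fun u hu => ?_
  · ext i j
    simp [hsymm j i]
  · have h := hpos (WithLp.toLp 2 u) fun h0 => hu (by simpa using congrArg WithLp.ofLp h0)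
    refine h.trans_eq ?_
    simp only [fundInner, dotProduct, Matrix.mulVec, Finset.mul_sum]
    refine Finset.sum_congr rfl fun i _ => Finset.sum_congr rfl fun j _ => ?_
    simp
    ring

/-- The Cauchy–Schwarz inequality on the orthogonal complement of `y`. -/
theorem gram_inner_sq_le {y : E n} (hy : y ≠ 0) (x u : E n) :
    (‖y‖ ^ 2 * inner ℝ x u - inner ℝ x y * inner ℝ y u) ^ 2 ≤
      (‖y‖ ^ 2 * ‖u‖ ^ 2 - inner ℝ y u ^ 2) * (‖y‖ ^ 2 * ‖x‖ ^ 2 - inner ℝ x y ^ 2) := by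
  have hpos : 0 < ‖y‖ ^ 2 := by positivity
  -- Both vectors are |y|² times the projections of x and u orthogonally to y; the resulting
  -- inequality carries the factor |y|⁴, which is cancelled at the end.
  have h1 := inner_sq_le (‖y‖ ^ 2 • x - inner ℝ x y • y) (‖y‖ ^ 2 • u - inner ℝ y u • y)
  simp only [← real_inner_self_eq_norm_sq (_ - _)] at h1
  simp only [inner_sub_left, inner_sub_right, real_inner_smul_left, inner_smul_right,
    real_inner_self_eq_norm_sq, real_inner_comm x y, real_inner_comm y u] at h1
  have h2 : (‖y‖ ^ 2) ^ 2 * (‖y‖ ^ 2 * inner ℝ x u - inner ℝ x y * inner ℝ y u) ^ 2 ≤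
      (‖y‖ ^ 2) ^ 2 * ((‖y‖ ^ 2 * ‖u‖ ^ 2 - inner ℝ y u ^ 2) *
        (‖y‖ ^ 2 * ‖x‖ ^ 2 - inner ℝ x y ^ 2)) := by
    nlinarith
  exact le_of_mul_le_mul_left h2 (by positivity)

/-! ### Convexity of the explicit metric in the fibres. -/

section explicit

variable {J : Set ℝ} {g q h T Tb : ℝ → ℝ} (D : RadialData J g q h T Tb) {γ ε : ℝ}

include D

/-- The second derivative of the explicit metric in a fibre. -/
theorem RadialData.dirDeriv_dirDeriv_explicitMetric {x y : E n}
    (hp : (x, y) ∈ slitTangent (radialDomain n J)) (u : E n) :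
    ‖y‖ ^ 2 * dirDeriv (0, u) (dirDeriv (0, u) (explicitMetric n h T Tb γ ε)) x y =
      formDerivNormSq T Tb γ ε x y * (‖y‖ ^ 2 * ‖u‖ ^ 2 - inner ℝ y u ^ 2)
        + ((ε * Tb ‖x‖ + 2 * γ) / √(alphaSq T Tb x y) ^ 3
          + 3 * γ * (‖y‖ ^ 2 * ‖x‖ ^ 2 - inner ℝ x y ^ 2) * Tb ‖x‖ / √(alphaSq T Tb x y) ^ 5)
          * (‖y‖ ^ 2 * inner ℝ x u - inner ℝ x y * inner ℝ y u) ^ 2 := by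
  have hJ : ‖x‖ ∈ J := hp.1
  have hx := D.ne_zero hJ
  have hc := (D.sub_pos hJ).ne'
  have hα := (D.sqrt_alphaSq_pos hp).ne'
  have hsq := D.sq_sqrt_alphaSq hp
  rw [dirDeriv_congr (g := fun x y =>
      formDerivInner h T Tb γ ε x y * inner ℝ x u + formDerivNormSq T Tb γ ε x y * inner ℝ y u)
    D.isOpen_slitTangent
    (fun x y hp => by rw [D.dirDeriv_explicitMetric γ ε hp]; simp) hp]
  have dα := D.hasDerivAt_sqrt_alphaSq_line hp 0 u
  have db := hasDerivAt_inner_line (x := x) (y := y) 0 u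
  have de := hasDerivAt_normSq_line (x := y) u
  have dyu := hasDerivAt_inner_const_line (x := y) u u
  simp only [smul_zero, add_zero] at dα db
  have dI := ((db.mul (((hasDerivAt_const (0 : ℝ) (Tb ‖x‖)).div
      (dα.const_mul (T ‖x‖ - ‖x‖ ^ 2 * Tb ‖x‖)) (by simpa using ⟨hc, hα⟩)).const_mul ε |>.add
    ((((hasDerivAt_const (0 : ℝ) (‖x‖ ^ 2 * Tb ‖x‖ + 2 * T ‖x‖)).div
      (dα.const_mul ((T ‖x‖ - ‖x‖ ^ 2 * Tb ‖x‖) ^ 2)) (by simpa using ⟨hc, hα⟩)).sub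
      (((db.pow 2).const_mul (T ‖x‖ * Tb ‖x‖)).div
        ((dα.pow 3).const_mul ((T ‖x‖ - ‖x‖ ^ 2 * Tb ‖x‖) ^ 2))
        (by simpa using ⟨hc, hα⟩))).const_mul γ))).const_add (h ‖x‖)).mul_const (inner ℝ x u)
  have dN := (((hasDerivAt_const (0 : ℝ) ε).div dα (by simpa using hα)).add
    ((((de.mul_const (‖x‖ ^ 2)).sub (db.pow 2)).const_mul γ).div (dα.pow 3)
      (by simpa using hα))).mul dyu
  have main : ∀ d, HasDerivAt (fun t : ℝ => formDerivInner h T Tb γ ε x (y + t • u) * inner ℝ x u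
      + formDerivNormSq T Tb γ ε x (y + t • u) * inner ℝ (y + t • u) u) d 0 →
      dirDeriv (0, u) (fun x y => formDerivInner h T Tb γ ε x y * inner ℝ x u
        + formDerivNormSq T Tb γ ε x y * inner ℝ y u) x y = d := fun d hd =>
    dirDeriv_eq_of_hasDerivAt ((D.smoothOn_formDeriv γ ε u).differentiableAt hp)
      (by simpa only [smul_zero, add_zero] using hd)
  rw [main _ (dI.add dN)]
  clear main dI dN dα db de dyu
  simp only [zero_smul, add_zero, Pi.pow_apply, Pi.add_apply, Pi.sub_apply,
    Pi.div_apply, formDerivNormSq, inner_zero_left, inner_zero_right, real_inner_self_eq_norm_sq,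
    zero_add]
  generalize hcc : T ‖x‖ - ‖x‖ ^ 2 * Tb ‖x‖ = c at *
  have hT : T ‖x‖ = c + ‖x‖ ^ 2 * Tb ‖x‖ := by rw [← hcc]; ring
  have he : ‖y‖ ^ 2 = (√(alphaSq T Tb x y) ^ 2 - Tb ‖x‖ * inner ℝ x y ^ 2) / c := by
    rw [hsq]; field_simp; ring
  simp only [he, hT]
  generalize √(alphaSq T Tb x y) = α at *
  generalize Tb ‖x‖ = K at *
  generalize ‖x‖ = r at *
  push_cast
  field_simp
  ring

/-- g_y(u,u) = F·F_uu + F_u². Off the line of y the first summand is positive; on that line it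
vanishes and F_u is a nonzero multiple of F. -/
theorem RadialData.fundInner_pos (hγ : 0 ≤ γ) (hε : 0 < ε) {x y : E n}
    (hp : (x, y) ∈ slitTangent (radialDomain n J))
    (hF : 0 < explicitMetric n h T Tb γ ε x y) {u : E n} (hu : u ≠ 0) :
    0 < fundInner (explicitMetric n h T Tb γ ε) x y u u := by
  have hU := D.isOpen_slitTangent (n := n)
  have hs := D.smoothOn_explicitMetric (n := n) γ ε
  have hL : SmoothOn (slitTangent (radialDomain n J))
      fun x y => explicitMetric n h T Tb γ ε x y ^ 2 := hs.pow 2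
  have hy : y ≠ 0 := hp.2
  have hα := D.sqrt_alphaSq_pos hp
  have hsq := D.sq_sqrt_alphaSq hp
  have hT := D.T_pos hp.1
  have hyy : 0 < ‖y‖ ^ 2 := by positivity
  have hval : fundInner (explicitMetric n h T Tb γ ε) x y u u =
      explicitMetric n h T Tb γ ε x y *
          dirDeriv (0, u) (dirDeriv (0, u) (explicitMetric n h T Tb γ ε)) x y
        + dirDeriv (0, u) (explicitMetric n h T Tb γ ε) x y ^ 2 := by
    have hsq' : ∀ x y : E n, (x, y) ∈ slitTangent (radialDomain n J) →
        dirDeriv (0, u) (fun x y => explicitMetric n h T Tb γ ε x y ^ 2) x y =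
          2 * explicitMetric n h T Tb γ ε x y *
            dirDeriv (0, u) (explicitMetric n h T Tb γ ε) x y := by
      intro x y hp
      simp only [pow_two]
      rw [dirDeriv_mul hs hs hp]
      ring
    rw [fundInner_eq hU hL hp, dirDeriv_congr hU hsq' hp,
      dirDeriv_mul ((SmoothOn.const _ _).mul hs) (hs.dirDeriv _) hp,
      dirDeriv_mul (SmoothOn.const _ _) hs hp, dirDeriv_const]
    ring
  rw [hval]
  have hsec := D.dirDeriv_dirDeriv_explicitMetric (γ := γ) (ε := ε) hp u
  have hgram := gram_inner_sq_le hy x u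
  have ha0 : 0 ≤ ‖y‖ ^ 2 * ‖u‖ ^ 2 - inner ℝ y u ^ 2 := sub_nonneg.2 (inner_sq_le y u)
  have hδ0 : 0 ≤ ‖y‖ ^ 2 * ‖x‖ ^ 2 - inner ℝ x y ^ 2 := by
    have := inner_sq_le x y
    linarith [mul_comm (‖x‖ ^ 2) (‖y‖ ^ 2)]
  set δ := ‖y‖ ^ 2 * ‖x‖ ^ 2 - inner ℝ x y ^ 2 with hδ
  set α := √(alphaSq T Tb x y)
  set N := formDerivNormSq T Tb γ ε x y with hN
  set κ := (ε * Tb ‖x‖ + 2 * γ) / α ^ 3 + 3 * γ * δ * Tb ‖x‖ / α ^ 5 with hκ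
  have hNpos : 0 < N := by
    rw [hN, formDerivNormSq]
    positivity
  -- The relation T|y|² = α² + T̄δ factors this quantity as (ε/α³ + 3γδ/α⁵)·T|y|², so the sign of T̄
  -- plays no role.
  have hNκ : 0 < N + κ * δ := by
    have : N + κ * δ = (ε / α ^ 3 + 3 * γ * δ / α ^ 5) * (T ‖x‖ * ‖y‖ ^ 2) := by
      have h1 : T ‖x‖ * ‖y‖ ^ 2 = α ^ 2 + Tb ‖x‖ * δ := by rw [hsq, hδ]; ring
      rw [h1, hN, hκ, formDerivNormSq]
      change ε / α + γ * δ / α ^ 3 + _ = _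
      field_simp
      ring
    rw [this]
    positivity
  rcases ha0.lt_or_eq with ha | ha
  · have hpos : 0 < ‖y‖ ^ 2 *
        dirDeriv (0, u) (dirDeriv (0, u) (explicitMetric n h T Tb γ ε)) x y := by
      rw [hsec]
      -- As 0 ≤ w² ≤ aδ, the sum Na + κw² is at least Na for κ ≥ 0 and at least (N + κδ)a for κ < 0.
      rcases le_or_gt 0 κ with hκ0 | hκ0
      · have := mul_pos hNpos ha
        positivity
      · have h1 := mul_pos hNκ ha
        have h2 := mul_le_mul_of_nonpos_left hgram hκ0.le
        nlinarith
    have := pos_of_mul_pos_right hpos hyy.le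
    positivity
  -- Equality in Cauchy–Schwarz: a zero Gram determinant makes u a multiple of y.
  · have hu' : u = (inner ℝ y u / ‖y‖ ^ 2) • y := by
      have h1 : ‖‖y‖ ^ 2 • u - inner ℝ y u • y‖ ^ 2 = 0 := by
        rw [← real_inner_self_eq_norm_sq]
        simp only [inner_sub_left, inner_sub_right, real_inner_smul_left, inner_smul_right,
          real_inner_self_eq_norm_sq, real_inner_comm y u]
        linear_combination -‖y‖ ^ 2 * ha
      have h2 : ‖y‖ ^ 2 • u = inner ℝ y u • y := by
        rw [← sub_eq_zero]
        simpa using h1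
      rw [div_eq_inv_mul, mul_smul, ← h2, smul_smul, inv_mul_cancel₀ hyy.ne', one_smul]
    have hc : inner ℝ y u / ‖y‖ ^ 2 ≠ 0 := by
      intro h0
      rw [h0, zero_smul] at hu'
      exact hu hu'
    have hw : ‖y‖ ^ 2 * inner ℝ x u - inner ℝ x y * inner ℝ y u = 0 := by
      rw [← ha, zero_mul] at hgram
      exact pow_eq_zero_iff two_ne_zero |>.1 (le_antisymm hgram (sq_nonneg _))
    rw [← ha, hw] at hsec
    have h0 : dirDeriv (0, u) (dirDeriv (0, u) (explicitMetric n h T Tb γ ε)) x y = 0 := by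
      have : ‖y‖ ^ 2 * dirDeriv (0, u) (dirDeriv (0, u) (explicitMetric n h T Tb γ ε)) x y = 0 := by
        rw [hsec]; ring
      exact (mul_eq_zero.1 this).resolve_left hyy.ne'
    have hE := dirDeriv_radial (k := 1) hs
      (fun x _ y c hc => by rw [pow_one]; exact sphMetric_homogeneous _ x y hc) hp
    rw [h0, mul_zero, zero_add]
    refine sq_pos_of_ne_zero ?_
    rw [hu', dirDeriv_snd_smul, hE]
    simpa using ⟨by simpa using hc, hF.ne'⟩

end explicit

/-- The fundamental tensor of a multiple of the Euclidean norm. -/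
theorem fundTensor_of_eq_norm {F : E n → E n → ℝ} {x : E n} {c : ℝ}
    (hF : ∀ y, F x y = ‖y‖ * c) (y : E n) (i j : Fin n) :
    fundTensor F x y i j = if i = j then c ^ 2 else 0 := by
  have h1 : ∀ w : E n, partialY j (fun x y => F x y ^ 2) x w = 2 * c ^ 2 * w j := by
    intro w
    have hd : HasFDerivAt (fun w : E n => F x w ^ 2) (c ^ 2 • (2 • innerSL ℝ w)) w := by
      simp only [hF, mul_pow, mul_comm _ (c ^ 2)]
      exact (hasStrictFDerivAt_norm_sq w).hasFDerivAt.const_mul (c ^ 2)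
    rw [partialY, hd.fderiv]
    simp [EuclideanSpace.inner_single_right]
    ring
  have h2 : HasFDerivAt (fun w : E n => partialY j (fun x y => F x y ^ 2) x w)
      ((2 * c ^ 2) • (EuclideanSpace.proj j : E n →L[ℝ] ℝ)) y := by
    simp only [h1]
    exact (EuclideanSpace.proj (𝕜 := ℝ) j : E n →L[ℝ] ℝ).hasFDerivAt.const_mul (2 * c ^ 2)
  rw [fundTensor, Matrix.of_apply, partialY, h2.fderiv]
  by_cases hij : i = j
  · subst hij; simp
  · simp [hij, Ne.symm hij]

theorem posDef_of_eq_norm {F : E n → E n → ℝ} {x : E n} {c : ℝ} (hc : 0 < c)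
    (hF : ∀ y, F x y = ‖y‖ * c) (y : E n) : (fundTensor F x y).PosDef := by
  have h := fundTensor_of_eq_norm hF y
  refine posDef_of_fundInner_pos (fun i j => by rw [h, h]; simp [eq_comm]) fun u hu => ?_
  have : fundInner F x y u u = c ^ 2 * ‖u‖ ^ 2 := by
    simp only [fundInner, h, EuclideanSpace.real_norm_sq_eq, Finset.mul_sum]
    refine Finset.sum_congr rfl fun i _ => ?_
    simp
    ring
  rw [this]
  positivity

theorem RadialData.isFinslerMetric {I J : Set ℝ} {g q h T Tb : ℝ → ℝ}
    (D : RadialData J g q h T Tb) (hJ : J = I ∩ Set.Ioi 0) {γ ε : ℝ} (hγ : 0 ≤ γ) (hε : 0 < ε)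
    (hφ : ∀ r ∈ I, ∀ s : ℝ, |s| ≤ r → 0 < phi h T Tb γ ε r s)
    (h0 : (0 : E n) ∈ radialDomain n I → ∀ y : E n, y ≠ 0 →
      ContDiffAt ℝ ∞ (fun p : E n × E n => explicitMetric n h T Tb γ ε p.1 p.2) (0, y)) :
    IsFinslerMetric (radialDomain n I) (explicitMetric n h T Tb γ ε) := by
  have hmem : ∀ x ∈ radialDomain n I, x ≠ 0 → ‖x‖ ∈ J := fun x hx hx0 =>
    hJ ▸ norm_mem_of_ne_zero hx hx0
  have hphi : ∀ x ∈ radialDomain n I, ∀ y : E n,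
      0 < phi h T Tb γ ε ‖x‖ (inner ℝ x y / ‖y‖) :=
    fun x hx y => hφ _ hx _ (abs_inner_div_norm_le x y)
  refine ⟨fun x hx y => mul_nonneg (norm_nonneg y) (hphi x hx y).le, fun x hx y hy => ?_,
    fun x _ y c hc => sphMetric_homogeneous _ x y hc, fun x hx y hy => ?_⟩
  · rcases eq_or_ne x 0 with rfl | hx0
    · exact h0 hx y hy
    · exact D.smoothOn_explicitMetric γ ε (x, y) ⟨hmem x hx hx0, hy⟩
  · rcases eq_or_ne x 0 with rfl | hx0
    -- At the origin the second argument of φ is always 0, so F(0, ·) is the Euclidean norm times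
    -- the positive constant φ(0, 0).
    · exact posDef_of_eq_norm (hphi 0 hx y) (fun w => by simp [explicitMetric, sphMetric]) y
    · have hp : (x, y) ∈ slitTangent (radialDomain n J) := ⟨hmem x hx hx0, hy⟩
      have hL : SmoothOn (slitTangent (radialDomain n J))
          fun x y => explicitMetric n h T Tb γ ε x y ^ 2 :=
        (D.smoothOn_explicitMetric γ ε).pow 2
      exact posDef_of_fundInner_pos (fundTensor_symm D.isOpen_slitTangent hL hp)
        fun u hu => D.fundInner_pos hγ hε hp
          (mul_pos (norm_pos_iff.2 hy) (hphi x hx y)) hu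

/-! ### The integral representation -/

/-- The radius is fixed, so T and T̄ are mere constants and no differential equation enters; the
summand sh(r) contributes a constant to φ/s. -/
theorem hasDerivAt_phi_div {h T Tb : ℝ → ℝ} (γ ε : ℝ) {r s : ℝ} (hs : s ≠ 0) (hsr : |s| < r)
    (hpos : ∀ s : ℝ, |s| ≤ r → 0 < T r - Tb r * (r ^ 2 - s ^ 2)) :
    HasDerivAt (fun t => phi h T Tb γ ε r t / t)
      (-(etaFun 1 γ ε (varphi T Tb r s) / (s ^ 2 * √(r ^ 2 - s ^ 2)))) s := by
  have hd := hpos s hsr.le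
  have hc : T r - r ^ 2 * Tb r ≠ 0 := by
    have := hpos 0 (by simpa using (abs_nonneg s).trans hsr.le)
    nlinarith
  have hu : 0 < r ^ 2 - s ^ 2 := by
    have := sq_lt_sq' (by linarith [neg_abs_le s, abs_nonneg s]) ((le_abs_self s).trans_lt hsr)
    linarith
  have hdsq := Real.sq_sqrt hd.le
  have hd0 := (Real.sqrt_pos.2 hd).ne'
  have hu0 := (Real.sqrt_pos.2 hu).ne'
  have heta : etaFun 1 γ ε (varphi T Tb r s) / (s ^ 2 * √(r ^ 2 - s ^ 2)) =
      (γ * (r ^ 2 - s ^ 2) / √(T r - Tb r * (r ^ 2 - s ^ 2)) ^ 3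
        + ε / √(T r - Tb r * (r ^ 2 - s ^ 2))) / s ^ 2 := by
    have h1 : -varphi T Tb r s = (r ^ 2 - s ^ 2) / √(T r - Tb r * (r ^ 2 - s ^ 2)) ^ 2 := by
      rw [varphi, ← div_neg, hdsq]
      congr 1
      ring
    rw [etaFun, h1, Real.sqrt_div hu.le, pow_one, Real.sqrt_sq (Real.sqrt_nonneg _)]
    generalize √(T r - Tb r * (r ^ 2 - s ^ 2)) = d at hd0
    field_simp
  have dD : HasDerivAt (fun t : ℝ => T r - Tb r * (r ^ 2 - t ^ 2)) (Tb r * (2 * s)) s := by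
    refine ((((hasDerivAt_id s).pow 2).const_sub (r ^ 2)).const_mul (Tb r)).const_sub (T r)
      |>.congr_deriv ?_
    simp
  have dd := dD.sqrt hd.ne'
  have dt := hasDerivAt_id s
  have main := (((((dt.mul_const (h r)).add
    (((dd.const_mul (r ^ 2)).div_const ((T r - r ^ 2 * Tb r) ^ 2)).const_mul γ)).add
    (((dt.pow 2).const_mul γ).mul ((hasDerivAt_const s (T r)).div
      (dd.const_mul ((T r - r ^ 2 * Tb r) ^ 2)) (by simpa using ⟨hc, hd0⟩)))).add
    ((dd.div_const (T r - r ^ 2 * Tb r)).const_mul ε)).div dt hs)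
  rw [heta]
  refine main.congr_deriv ?_
  simp only [Pi.mul_apply, Pi.pow_apply, Pi.add_apply, Pi.div_apply, id]
  clear main dd dD heta
  generalize hcc : T r - r ^ 2 * Tb r = c at *
  generalize √(T r - Tb r * (r ^ 2 - s ^ 2)) = d at *
  -- T̄ and T are expressed through d² = T − T̄(r² − s²) and c, using d² − c = T̄s²; this is
  -- possible because s ≠ 0 and leaves a rational identity.
  have hK : Tb r = (d ^ 2 - c) / s ^ 2 := by
    rw [hdsq, ← hcc]; field_simp; ring
  have hT : T r = c + r ^ 2 * Tb r := by rw [← hcc]; ring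
  rw [hT, hK]
  push_cast
  field_simp
  ring

end SphSymFinsler

/-! ### The theorem, from the radial data on the positive radii of I. -/

theorem mainTheorem9 (n : ℕ) (hn : 2 ≤ n) (I : Set ℝ)
    (hI : IsOpen (SphSymFinsler.radialDomain n I))
    (g h A Tb : ℝ → ℝ) (γ ε : ℝ)
    (hg : ∀ r ∈ I, 0 < r → ContDiffAt ℝ ((⊤ : ℕ∞) : WithTop ℕ∞) g r)
    (hh : ∀ r ∈ I, 0 < r → ContDiffAt ℝ ((⊤ : ℕ∞) : WithTop ℕ∞) h r)
    (hne : ∀ r ∈ I, 0 < r → 1 - 2 * r ^ 2 * g r ≠ 0)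
    (hint : SphSymFinsler.IsIntegralChoice I g A Tb)
    (hpos : ∀ r ∈ I, ∀ s : ℝ, |s| ≤ r →
      0 < SphSymFinsler.Tfun g A r - Tb r * (r ^ 2 - s ^ 2)) :
    -- `F` is a Douglas metric of scalar flag curvature whenever it is a Finsler metric
    (SphSymFinsler.IsFinslerMetric (SphSymFinsler.radialDomain n I)
        (SphSymFinsler.explicitMetric n h (SphSymFinsler.Tfun g A) Tb γ ε) →
      SphSymFinsler.IsDouglas (SphSymFinsler.radialDomain n I)
        (SphSymFinsler.explicitMetric n h (SphSymFinsler.Tfun g A) Tb γ ε) ∧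
      SphSymFinsler.HasScalarFlagCurvature (SphSymFinsler.radialDomain n I)
        (SphSymFinsler.explicitMetric n h (SphSymFinsler.Tfun g A) Tb γ ε)) ∧
    -- `F` is a Finsler metric as soon as `φ` is positive (and `F` is smooth over the origin)
    (0 ≤ γ → 0 < ε → (∀ r ∈ I, ∀ s : ℝ, |s| ≤ r →
        0 < SphSymFinsler.phi h (SphSymFinsler.Tfun g A) Tb γ ε r s) →
      ((0 : SphSymFinsler.E n) ∈ SphSymFinsler.radialDomain n I → ∀ y : SphSymFinsler.E n, y ≠ 0 →
        ContDiffAt ℝ ((⊤ : ℕ∞) : WithTop ℕ∞)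
          (fun p : SphSymFinsler.E n × SphSymFinsler.E n =>
            SphSymFinsler.explicitMetric n h (SphSymFinsler.Tfun g A) Tb γ ε p.1 p.2) (0, y)) →
      SphSymFinsler.IsFinslerMetric (SphSymFinsler.radialDomain n I)
        (SphSymFinsler.explicitMetric n h (SphSymFinsler.Tfun g A) Tb γ ε)) ∧
    -- `φ = s (h - ∫ η(φ(r, s)) / (s² √(r² - s²)) ds)` with the function `η` for `m = 1`
    (∀ r ∈ I, ∀ s : ℝ, s ≠ 0 → |s| < r →
      HasDerivAt (fun t => SphSymFinsler.phi h (SphSymFinsler.Tfun g A) Tb γ ε r t / t)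
        (-(SphSymFinsler.etaFun 1 γ ε
              (SphSymFinsler.varphi (SphSymFinsler.Tfun g A) Tb r s)
            / (s ^ 2 * √(r ^ 2 - s ^ 2)))) s) := by
  have hn0 : 0 < n := by omega
  have : Nonempty (Fin n) := ⟨⟨0, hn0⟩⟩
  have : Nontrivial (SphSymFinsler.E n) := inferInstance
  have D := SphSymFinsler.radialData_of_isIntegralChoice
    (SphSymFinsler.isOpen_pos_radii hn0 hI) (fun r hr => hr.2)
    (fun r hr => hg r hr.1 hr.2) (fun r hr => hh r hr.1 hr.2) (fun r hr => hne r hr.1 hr.2)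
    ⟨fun r hr => hint.hasDerivAt_A r hr.1, fun r hr => hint.hasDerivAt_Tb r hr.1⟩
    (fun r hr => hpos r hr.1)
  exact ⟨fun hF => ⟨D.isDouglas rfl hI hF, D.hasScalarFlagCurvature rfl hI hF⟩,
    fun hγ hε hφ h0 => D.isFinslerMetric rfl hγ hε hφ h0,
    fun r hr s hs hsr => SphSymFinsler.hasDerivAt_phi_div γ ε hs hsr (hpos r hr)⟩
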